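/- Conventions. For $E=\mathbb{R}^m$, $\mathcal{S}^{(1)}(E)$ is the Gelfand--Shilov space of all $f$ with $\|f\,e^{h|\cdot|}\|_{L^\infty}<\infty$ and $\|\hat f\,e^{h|\cdot|}\|_{L^\infty}<\infty$ for every $h>0$, where $\hat f(\omega)=\int f(t)e^{-2\pi i t\cdot\omega}dt$, with the topology given by these norms; $\mathcal{S}^{(1)'}(E)$ is its dual (with the strong topology), and $\langle\cdot,\cdot\rangle$ extends $\int f\bar g$. Put $M_\omega T_x g(t)=e^{2\pi i\omega\cdot t}g(t-x)$, $$V_gf(x,\omega)=\int f(t)\overline{M_\omega T_xg(t)}\,dt,\qquad W(f,g)(x,\omega)=\int f(x+\tfrac t2)\overline{g(x-\tfrac t2)}e^{-2\pi i\omega\cdot t}\,dt .$$ A vector $\vec f=(f_1,\dots,f_n)$ of functions on $\mathbb{R}^d$ is identified with the tensor product $\prod_{j=1}^n f_j(t_j)$ on $\mathbb{R}^{nd}$. Theorem. Let $a\in\mathcal{S}^{(1)'}(\mathbb{R}^{2nd})$ and let $\vec\varphi=(\varphi_1,\dots,\varphi_n)$, $\vec\phi=(\phi_1,\dots,\phi_n)$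 with $\varphi_j,\phi_j\in\mathcal{S}^{(1)}(\mathbb{R}^d)$. (i) There is a unique continuous linear operator $A_a^{\varphi}:\mathcal{S}^{(1)}(\mathbb{R}^{nd})\to\mathcal{S}^{(1)'}(\mathbb{R}^{nd})$ (the localization operator with symbol $a$ and window $\varphi=(\vec\varphi,\vec\phi)$) with $$\langle A_a^{\varphi}F,G\rangle=\langle a,\overline{V_{\vec\varphi}F}\;V_{\vec\phi}G\rangle\qquad(F,G\in\mathcal{S}^{(1)}(\mathbb{R}^{nd})).$$ (ii) $W(\vec\phi,\vec\varphi)(x,\omega)=\prod_{j=1}^nW(\phi_j,\varphi_j)(x_j,\omega_j)$, and the convolution $\sigma=a*W(\vec\phi,\vec\varphi)$, that is, the function $\sigma(z)=\langle a,\overline{W(\vec\phi,\vec\varphi)(z-\cdot)}\rangle$, is a well-defined element of $\mathcal{S}^{(1)'}(\mathbb{R}^{2nd})$. (iii) For every $\tau\in\mathcal{S}^{(1)'}(\mathbb{R}^{2nd})$ the Weyl pseudodifferential operator $L_\tau F(x)=\iint\tau(\frac{x+y}2,\omega)F(y)e^{2\pi i(x-y)\cdot\omega}\,dy\,d\omega$,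 understood in the distributional sense (with $x=p+\frac t2$, $y=p-\frac t2$, $\langle L_\tau F,G\rangle$ is the action of $\tau$ on the test function $(p,\omega)\mapsto\int F(p-\frac t2)\overline{G(p+\frac t2)}e^{2\pi it\cdot\omega}\,dt$), is a well-defined continuous linear operator $\mathcal{S}^{(1)}(\mathbb{R}^{nd})\to\mathcal{S}^{(1)'}(\mathbb{R}^{nd})$. (iv) $A_a^{\varphi}$ is the Weyl pseudodifferential operator with Weyl symbol $$\sigma=a*W(\vec\phi,\vec\varphi)=a*\Big(\prod_{j=1}^nW(\phi_j,\varphi_j)\Big),$$ i.e. $A_a^{\varphi}=L_\sigma$. In particular, for all $\vec f=(f_1,\dots,f_n)$, $\vec g=(g_1,\dots,g_n)$ with $f_j,g_j\in\mathcal{S}^{(1)}(\mathbb{R}^d)$, $$\langle A_a^{\varphi}\vec f,\vec g\rangle=\langle L_{a*W(\vec\phi,\vec\varphi)}\vec f,\vec g\rangle .$$ -/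

import Mathlib

open MeasureTheory Real Complex
open scoped FourierTransform ComplexConjugate InnerProductSpace NNReal

noncomputable section

/-- `ℝ^d` with its Euclidean norm and Lebesgue measure. -/
abbrev Eucl (d : ℕ) : Type := EuclideanSpace ℝ (Fin d)

/-- `ℝ^{nd}`: vectors `t = (t_1, …, t_n)` with blocks `t_j ∈ ℝ^d`, with the Euclidean norm. -/
abbrev MEucl (n d : ℕ) : Type := EuclideanSpace ℝ (Fin n × Fin d)

/-- The block `t_j ∈ ℝ^d` of `t = (t_1, …, t_n) ∈ ℝ^{nd}`. -/
def block {n d : ℕ} (j : Fin n) (t : MEucl n d) : Eucl d := WithLp.toLp 2 fun k => t (j, k)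

/-- The phase space `E × E` of points `(x, ω)`, with the Euclidean norm and Lebesgue measure;
for `E = ℝ^{nd}` this is `ℝ^{2nd}`. -/
abbrev Phase (E : Type) [NormedAddCommGroup E] : Type := WithLp 2 (E × E)

section Space

variable (E : Type) [NormedAddCommGroup E] [InnerProductSpace ℝ E] [FiniteDimensional ℝ E]
  [MeasurableSpace E] [BorelSpace E]

/-- `‖f(x) e^{h|x|}‖_∞ < ∞` for every `h > 0`. -/
def ExpDecay {E : Type} [NormedAddCommGroup E] (f : E → ℂ) : Prop :=
  ∀ h : ℝ, 0 < h → ∃ C : ℝ, ∀ x, ‖f x‖ * Real.exp (h * ‖x‖) ≤ C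

variable {E} in
theorem ExpDecay.integrable {f : E → ℂ} (hc : Continuous f) (hf : ExpDecay f) :
    Integrable f := by
  obtain ⟨C, hC⟩ := hf 1 one_pos
  set k : ℕ := Module.finrank ℝ E + 1 with hk
  have hI : Integrable (fun x : E => (1 + ‖x‖) ^ (-(k : ℝ))) :=
    integrable_one_add_norm (by rw [hk]; push_cast; linarith)
  refine (hI.const_mul (C * (k.factorial * Real.exp 1))).mono' hc.aestronglyMeasurable
    (Filter.Eventually.of_forall fun x => ?_)
  have h1 : 0 < 1 + ‖x‖ := by positivity
  have h2 := Real.pow_div_factorial_le_exp (1 + ‖x‖) h1.le k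
  have hfac : (0 : ℝ) < k.factorial := by exact_mod_cast k.factorial_pos
  rw [div_le_iff₀ hfac, Real.exp_add] at h2
  have h3 := hC x
  rw [one_mul] at h3
  rw [Real.rpow_neg h1.le, Real.rpow_natCast, ← div_eq_mul_inv, le_div_iff₀ (by positivity)]
  calc ‖f x‖ * (1 + ‖x‖) ^ k ≤ ‖f x‖ * (Real.exp 1 * Real.exp ‖x‖ * k.factorial) := by gcongr
    _ = (‖f x‖ * Real.exp ‖x‖) * (k.factorial * Real.exp 1) := by ring
    _ ≤ C * (k.factorial * Real.exp 1) := by gcongr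

/-- The Gelfand–Shilov functions as a subspace of all functions: `f` and its Fourier transform
`𝓕 f (ω) = ∫ f(t) e^{-2πi⟨t, ω⟩} dt` decay faster than every exponential. (Since then `𝓕 f ∈ L¹`,
every such class in `L^∞` has a unique continuous representative, which is the one used here.) -/
def gelfandShilovSubmodule : Submodule ℂ (E → ℂ) where
  carrier := {f | Continuous f ∧ ExpDecay f ∧ ExpDecay (𝓕 f)}
  add_mem' := by
    rintro f g ⟨hf, hf', hf''⟩ ⟨hg, hg', hg''⟩
    have key : ∀ {u v : E → ℂ}, ExpDecay u → ExpDecay v → ExpDecay (fun x => u x + v x) := by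
      intro u v hu hv h hh
      obtain ⟨C, hC⟩ := hu h hh
      obtain ⟨D, hD⟩ := hv h hh
      refine ⟨C + D, fun x => ?_⟩
      calc ‖u x + v x‖ * Real.exp (h * ‖x‖) ≤ (‖u x‖ + ‖v x‖) * Real.exp (h * ‖x‖) := by
            gcongr; exact norm_add_le _ _
        _ ≤ C + D := by rw [add_mul]; exact add_le_add (hC x) (hD x)
    have hF : 𝓕 (f + g) = fun x => 𝓕 f x + 𝓕 g x := by
      funext w
      simp only [Real.fourier_eq, Pi.add_apply, smul_add]
      exact integral_add
        ((Real.fourierIntegral_convergent_iff w).2 (hf'.integrable hf))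
        ((Real.fourierIntegral_convergent_iff w).2 (hg'.integrable hg))
    refine ⟨hf.add hg, key hf' hg', ?_⟩
    rw [hF]
    exact key hf'' hg''
  zero_mem' := by
    have hF : 𝓕 (0 : E → ℂ) = 0 := by
      funext w
      simp [Real.fourier_eq]
    refine ⟨continuous_zero, fun h _ => ⟨0, by simp⟩, ?_⟩
    rw [hF]
    exact fun h _ => ⟨0, by simp⟩
  smul_mem' := by
    rintro c f ⟨hf, hf', hf''⟩
    have key : ∀ {u : E → ℂ}, ExpDecay u → ExpDecay (fun x => c * u x) := by
      intro u hu h hh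
      obtain ⟨C, hC⟩ := hu h hh
      refine ⟨‖c‖ * C, fun x => ?_⟩
      rw [norm_mul, mul_assoc]
      exact mul_le_mul_of_nonneg_left (hC x) (norm_nonneg _)
    have hF : 𝓕 (c • f) = fun x => c * 𝓕 f x := by
      funext w
      simp only [Real.fourier_eq, Pi.smul_apply, smul_comm _ c]
      rw [integral_smul, smul_eq_mul]
    refine ⟨continuous_const.mul hf, key hf', ?_⟩
    rw [hF]
    exact key hf''

/-- The Gelfand–Shilov space `𝓢^{(1)}(E)`. -/
def GS : Type := gelfandShilovSubmodule E

instance : AddCommGroup (GS E) := inferInstanceAs (AddCommGroup (gelfandShilovSubmodule E))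
instance : Module ℂ (GS E) := inferInstanceAs (Module ℂ (gelfandShilovSubmodule E))
instance : CoeFun (GS E) (fun _ => E → ℂ) := ⟨fun f => f.1⟩

variable {E}

theorem ExpDecay.bddAbove {E : Type} [NormedAddCommGroup E] {f : E → ℂ} (hf : ExpDecay f)
    (h : ℝ≥0) : BddAbove (Set.range fun x => ‖f x‖ * Real.exp (h * ‖x‖)) := by
  obtain ⟨C, hC⟩ := hf (h + 1) (by positivity)
  refine ⟨C, ?_⟩
  rintro _ ⟨x, rfl⟩
  refine le_trans ?_ (hC x)
  have : (h : ℝ) * ‖x‖ ≤ (h + 1) * ‖x‖ := by nlinarith [norm_nonneg x]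
  exact mul_le_mul_of_nonneg_left (Real.exp_le_exp.2 this) (norm_nonneg _)

/-- The seminorm `f ↦ sup_x |T f(x)| e^{h|x|}`, for a linear map `T` into functions of exponential
decay. -/
def expSeminorm (T : GS E →ₗ[ℂ] (E → ℂ)) (hT : ∀ f, ExpDecay (T f)) (h : ℝ≥0) :
    Seminorm ℂ (GS E) :=
  Seminorm.of (fun f => ⨆ x, ‖T f x‖ * Real.exp (h * ‖x‖))
    (by
      intro f g
      refine ciSup_le fun x => ?_
      rw [map_add]
      calc ‖T f x + T g x‖ * Real.exp (h * ‖x‖)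
          ≤ ‖T f x‖ * Real.exp (h * ‖x‖) + ‖T g x‖ * Real.exp (h * ‖x‖) := by
            rw [← add_mul]; gcongr; exact norm_add_le _ _
        _ ≤ _ := add_le_add (le_ciSup ((hT f).bddAbove h) x) (le_ciSup ((hT g).bddAbove h) x))
    (by
      intro c f
      rw [map_smul, Real.mul_iSup_of_nonneg (norm_nonneg c)]
      simp [mul_assoc])

/-- The inclusion of `𝓢^{(1)}(E)` in the space of functions. -/
def GS.incl : GS E →ₗ[ℂ] (E → ℂ) := (gelfandShilovSubmodule E).subtype

/-- The Fourier transform on `𝓢^{(1)}(E)`. -/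
def GS.fourier : GS E →ₗ[ℂ] (E → ℂ) where
  toFun f := 𝓕 (f : E → ℂ)
  map_add' f g := by
    funext w
    change 𝓕 ((f : E → ℂ) + (g : E → ℂ)) w = 𝓕 (f : E → ℂ) w + 𝓕 (g : E → ℂ) w
    simp only [Real.fourier_eq, Pi.add_apply, smul_add]
    exact integral_add
      ((Real.fourierIntegral_convergent_iff w).2 (f.2.2.1.integrable f.2.1))
      ((Real.fourierIntegral_convergent_iff w).2 (g.2.2.1.integrable g.2.1))
  map_smul' c f := by
    funext w
    change 𝓕 (c • (f : E → ℂ)) w = c • 𝓕 (f : E → ℂ) w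
    simp only [Real.fourier_eq, Pi.smul_apply, smul_comm _ c]
    rw [integral_smul]

/-- The seminorms `‖f e^{h|·|}‖_∞` and `‖𝓕 f e^{h|·|}‖_∞`, `h ≥ 0`, which define the topology of
`𝓢^{(1)}(E)`. -/
def gsSeminorms : SeminormFamily ℂ (GS E) (ℝ≥0 ⊕ ℝ≥0) :=
  Sum.elim (expSeminorm GS.incl fun f => f.2.2.1) (expSeminorm GS.fourier fun f => f.2.2.2)

instance : TopologicalSpace (GS E) := (gsSeminorms (E := E)).moduleFilterBasis.topology
instance : IsTopologicalAddGroup (GS E) :=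
  (gsSeminorms (E := E)).addGroupFilterBasis.isTopologicalAddGroup
instance : ContinuousSMul ℂ (GS E) := (gsSeminorms (E := E)).moduleFilterBasis.continuousSMul

/-- The complex conjugate of a Gelfand–Shilov function. -/
def GS.conj (f : GS E) : GS E :=
  ⟨fun x => starRingEnd ℂ (f x), by
    refine ⟨Complex.continuous_conj.comp f.2.1, ?_, ?_⟩
    · intro h hh
      obtain ⟨C, hC⟩ := f.2.2.1 h hh
      exact ⟨C, fun x => by simpa using hC x⟩
    · intro h hh
      obtain ⟨C, hC⟩ := f.2.2.2 h hh
      refine ⟨C, fun x => ?_⟩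
      have : 𝓕 (fun x => starRingEnd ℂ (f x)) x = starRingEnd ℂ (𝓕 (f : E → ℂ) (-x)) := by
        rw [Real.fourier_eq', Real.fourier_eq', ← integral_conj]
        refine integral_congr_ae (Filter.Eventually.of_forall fun v => ?_)
        simp [← Complex.exp_conj, Complex.conj_ofNat]
      rw [this, RCLike.norm_conj, ← norm_neg x]
      exact hC (-x)⟩

end Space

section Operators

variable {E : Type} [NormedAddCommGroup E] [InnerProductSpace ℝ E] [FiniteDimensional ℝ E]
  [MeasurableSpace E] [BorelSpace E]

variable (E) in
/-- The dual space `𝓢^{(1)'}(E)`: continuous linear functionals; a function `a` acts by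
`H ↦ ∫ a H`. -/
abbrev GSDual : Type := GS E →L[ℂ] ℂ

/-- The bracket `⟨u, g⟩`, extending `∫ u(t) conj(g(t)) dt` to `𝓢^{(1)'} × 𝓢^{(1)}`. -/
def bracket (u : GSDual E) (g : GS E) : ℂ := u g.conj

/-- `T_x f(t) = f(t - x)`. -/
def timeShift (x : E) (f : E → ℂ) (t : E) : ℂ := f (t - x)

/-- `M_ω f(t) = e^{2πi⟨ω, t⟩} f(t)`. -/
def freqShift (ω : E) (f : E → ℂ) (t : E) : ℂ :=
  Complex.exp (2 * π * Complex.I * (⟪ω, t⟫_ℝ : ℝ)) * f t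

/-- The short-time Fourier transform `V_g f(x, ω) = ∫ f(t) conj(M_ω T_x g(t)) dt`. -/
def stft (g f : E → ℂ) (z : Phase E) : ℂ :=
  ∫ t, f t * conj (freqShift z.snd (timeShift z.fst g) t)

/-- The (cross-)Wigner transform
`W(f, g)(x, ω) = ∫ f(x + t/2) conj(g(x - t/2)) e^{-2πi⟨ω, t⟩} dt`. -/
def wigner (f g : E → ℂ) (z : Phase E) : ℂ :=
  ∫ t, f (z.fst + (2⁻¹ : ℝ) • t) * conj (g (z.fst - (2⁻¹ : ℝ) • t)) *
    Complex.exp (-(2 * π * Complex.I * (⟪z.snd, t⟫_ℝ : ℝ)))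

/-- `A : 𝓢^{(1)} → 𝓢^{(1)'}` is the localization operator with symbol `a`, analysis window `φ` and
synthesis window `ψ`, i.e. `A F = ∫ a(x, ω) V_φ F(x, ω) M_ω T_x ψ dx dω` in the weak sense:
`⟨A F, G⟩ = ⟨a V_φ F, V_ψ G⟩ = ⟨a, conj(V_φ F) V_ψ G⟩`, where `conj(V_φ F) V_ψ G` is an
admissible test function. -/
def IsLocalizationOperator (a : GSDual (Phase E)) (φ ψ : GS E) (A : GS E →L[ℂ] GSDual E) : Prop :=
  ∀ F G : GS E, ∃ H : GS (Phase E),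
    (∀ z, H z = conj (stft φ F z) * stft ψ G z) ∧ bracket (A F) G = bracket a H

/-- `L : 𝓢^{(1)} → 𝓢^{(1)'}` is the Weyl pseudodifferential operator with Weyl symbol `σ`, i.e.
`L F(x) = ∬ σ((x+y)/2, ω) F(y) e^{2πi⟨x-y, ω⟩} dy dω` as an oscillatory integral in the
distributional sense: in `⟨L F, G⟩ = ∭ σ((x+y)/2, ω) F(y) conj(G(x)) e^{2πi⟨x-y, ω⟩} dx dy dω` put
`x = p + t/2`, `y = p - t/2`, and let `σ` act on the resulting test function of `(p, ω)`. -/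
def IsWeylOperator (σ : GSDual (Phase E)) (L : GS E →L[ℂ] GSDual E) : Prop :=
  ∀ F G : GS E, ∃ H : GS (Phase E),
    (∀ z, H z = ∫ t, F (z.fst - (2⁻¹ : ℝ) • t) * conj (G (z.fst + (2⁻¹ : ℝ) • t)) *
      Complex.exp (2 * π * Complex.I * (⟪t, z.snd⟫_ℝ : ℝ))) ∧
    bracket (L F) G = σ H

/-- The distribution `σ` is the convolution `a ∗ Ψ`, i.e. it is the function
`s(z) = ∫ a(w) Ψ(z - w) dw`, where `a` acts on the test function `w ↦ Ψ(z - w)`. -/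
def IsConvolution (a : GSDual E) (Ψ : E → ℂ) (σ : GSDual E) : Prop :=
  ∃ s : E → ℂ, (∀ z, ∃ R : GS E, (∀ w, R w = Ψ (z - w)) ∧ s z = a R) ∧
    ∀ H : GS E, Integrable (fun z => s z * H z) ∧ σ H = ∫ z, s z * H z

end Operators

section Tensor

variable {n d : ℕ}

theorem norm_le_sum_block (t : MEucl n d) : ‖t‖ ≤ ∑ j, ‖block j t‖ := by
  have h : ‖t‖ ^ 2 = ∑ j, ‖block j t‖ ^ 2 := by
    simp only [EuclideanSpace.norm_sq_eq, block]
    rw [Fintype.sum_prod_type]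
  refine (sq_le_sq₀ (norm_nonneg _) (Finset.sum_nonneg fun _ _ => norm_nonneg _)).1 ?_
  rw [h]
  exact Finset.sum_sq_le_sq_sum_of_nonneg fun _ _ => norm_nonneg _

theorem inner_eq_sum_block (t w : MEucl n d) : ⟪t, w⟫_ℝ = ∑ j, ⟪block j t, block j w⟫_ℝ := by
  simp only [PiLp.inner_apply, block]
  rw [Fintype.sum_prod_type]

/-- The blocks identify `ℝ^{nd}` with `(ℝ^d)^n`, with the product measure. -/
theorem measurePreserving_block :
    MeasurePreserving (fun (t : MEucl n d) (j : Fin n) => block j t) := by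
  have h2 : MeasurePreserving (MeasurableEquiv.curry (Fin n) (Fin d) ℝ).symm := by
    refine ⟨(MeasurableEquiv.curry (Fin n) (Fin d) ℝ).symm.measurable, ?_⟩
    refine (Measure.pi_eq fun s hs => ?_).symm
    rw [MeasurableEquiv.map_apply]
    have : (MeasurableEquiv.curry (Fin n) (Fin d) ℝ).symm ⁻¹' (Set.univ.pi s) =
        Set.univ.pi fun j => Set.univ.pi fun k => s (j, k) := by
      ext x
      simp [MeasurableEquiv.coe_curry_symm, Set.mem_pi, Function.uncurry]
    rw [this, volume_pi_pi, Fintype.prod_prod_type]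
    simp [volume_pi_pi]
  have h3 : MeasurePreserving
      (fun (u : Fin n → Fin d → ℝ) (j : Fin n) => (WithLp.toLp 2 (u j) : Eucl d)) :=
    volume_preserving_pi fun _ => PiLp.volume_preserving_toLp (Fin d)
  exact h3.comp (h2.symm.comp (PiLp.volume_preserving_ofLp (Fin n × Fin d)))

theorem integral_prod_block (f : Fin n → Eucl d → ℂ) :
    ∫ t : MEucl n d, ∏ j, f j (block j t) = ∏ j, ∫ x, f j x := by
  rw [← integral_fintype_prod_volume_eq_prod]
  let e : MEucl n d ≃ᵐ (Fin n → Eucl d) :=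
    (MeasurableEquiv.toLp 2 (Fin n × Fin d → ℝ)).symm.trans
      ((MeasurableEquiv.curry (Fin n) (Fin d) ℝ).trans
        (MeasurableEquiv.piCongrRight fun _ => MeasurableEquiv.toLp 2 (Fin d → ℝ)))
  have he : MeasurableEmbedding (fun (t : MEucl n d) (j : Fin n) => block j t) :=
    e.measurableEmbedding
  exact measurePreserving_block.integral_comp he fun y => ∏ j, f j (y j)

theorem ExpDecay.prod_block {f : Fin n → Eucl d → ℂ} (hf : ∀ j, ExpDecay (f j)) :
    ExpDecay (fun t : MEucl n d => ∏ j, f j (block j t)) := by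
  intro h hh
  choose C hC using fun j => hf j h hh
  refine ⟨∏ j, C j, fun t => ?_⟩
  calc ‖∏ j, f j (block j t)‖ * Real.exp (h * ‖t‖)
      ≤ (∏ j, ‖f j (block j t)‖) * Real.exp (∑ j, h * ‖block j t‖) := by
        rw [norm_prod, ← Finset.mul_sum]
        gcongr
        exact norm_le_sum_block t
    _ = ∏ j, ‖f j (block j t)‖ * Real.exp (h * ‖block j t‖) := by
        rw [Real.exp_sum, Finset.prod_mul_distrib]
    _ ≤ ∏ j, C j := Finset.prod_le_prod (fun _ _ => by positivity) fun j _ => hC j _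

/-- The tensor product `f_1 ⊗ … ⊗ f_n ∈ 𝓢^{(1)}(ℝ^{nd})`, `t ↦ ∏_j f_j(t_j)`, of a vector
`(f_1, …, f_n)` of functions in `𝓢^{(1)}(ℝ^d)`. -/
def GS.tensor (f : Fin n → GS (Eucl d)) : GS (MEucl n d) :=
  ⟨fun t => ∏ j, f j (block j t), by
    refine ⟨?_, ExpDecay.prod_block fun j => (f j).2.2.1, ?_⟩
    · refine continuous_finsetProd _ fun j _ => (f j).2.1.comp ?_
      unfold block
      fun_prop
    · have : 𝓕 (fun t : MEucl n d => ∏ j, f j (block j t)) =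
          fun w => ∏ j, 𝓕 (f j : Eucl d → ℂ) (block j w) := by
        funext w
        simp only [Real.fourier_eq']
        rw [← integral_prod_block]
        refine integral_congr_ae (Filter.Eventually.of_forall fun t => ?_)
        simp only [smul_eq_mul]
        rw [Finset.prod_mul_distrib, ← Complex.exp_sum, inner_eq_sum_block]
        congr 2
        push_cast
        rw [Finset.mul_sum, Finset.sum_mul]
      rw [this]
      exact ExpDecay.prod_block fun j => (f j).2.2.2⟩

/-- The point `(x_j, ω_j) ∈ ℝ^{2d}` of `(x, ω) ∈ ℝ^{2nd}`. -/
def phaseBlock (j : Fin n) (z : Phase (MEucl n d)) : Phase (Eucl d) :=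
  WithLp.toLp 2 (block j z.fst, block j z.snd)

end Tensor

end

/-! ### Seminorm estimates, Fourier inversion and reflected translates. -/

namespace GS

variable {E : Type} [NormedAddCommGroup E] [InnerProductSpace ℝ E] [FiniteDimensional ℝ E]
  [MeasurableSpace E] [BorelSpace E]

/-! Substituting `t ↦ -t` shows that the test function on which a Weyl symbol acts is the
cross-Wigner transform, so `⟨L_σ F, G⟩ = σ(W(F, G))`. For `σ = a * Ψ` with `Ψ = W(ψ, φ)` this is `∫
a(Ψ(z - ·)) W(F, G)(z) dz`. Moving `a` outside the integral gives `a` applied to `w ↦ ∫ W(F, G)(z)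
Ψ(z - w) dz`, and Moyal's identity (`integral_wigner_mul_wigner_sub`) evaluates this function as
`V_φ F(w) conj(V_ψ G(w))`. Its conjugate is the test function defining the localization operator,
and the bracket supplies exactly that conjugation.

Two analytic points carry the argument. First, the cross-Wigner transform must map pairs of
Gelfand–Shilov functions to Gelfand–Shilov functions, with bounds on the seminorms. Decay in `x` is
read off the kernel; decay in `ω` follows from the symmetry `W(F, G)(x, ω) = W(𝓕 F, 𝓕 G)(ω, -x)`;
decay of the Fourier transform follows because `𝓕 (W(F, G))` is, up to scaling and a rotation of
phase space, the Wigner transform of `F` and the reflection of `G`.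

Second, `a` must commute with the integral (`apply_corrGS`). A continuous functional is bounded by a
single weighted norm, hence by Hahn–Banach it factors through a Banach space of pairs of bounded
continuous functions. There the test function is a Bochner integral of reflected translates, and
continuous functionals pass through it.

Uniqueness throughout comes from test functions being determined by their values, and operators by
their brackets. -/

@[ext] theorem ext {f g : GS E} (h : ∀ x, f x = g x) : f = g := Subtype.ext (funext h)

theorem continuous_coe (f : GS E) : Continuous (f : E → ℂ) := f.2.1

theorem expDecay (f : GS E) : ExpDecay (f : E → ℂ) := f.2.2.1

theorem expDecay_fourier (f : GS E) : ExpDecay (𝓕 (f : E → ℂ)) := f.2.2.2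

theorem integrable (f : GS E) : Integrable (f : E → ℂ) := f.expDecay.integrable f.continuous_coe

@[simp] theorem add_apply (f g : GS E) (x : E) : (f + g) x = f x + g x := rfl
@[simp] theorem smul_apply (c : ℂ) (f : GS E) (x : E) : (c • f) x = c * f x := rfl
@[simp] theorem conj_apply (f : GS E) (x : E) : f.conj x = conj (f x) := rfl

theorem withSeminorms : WithSeminorms (gsSeminorms (E := E)) := ⟨rfl⟩

/-- The sum of the weighted supremum norms of `f` and `𝓕 f`. -/
noncomputable def wnorm (h : ℝ≥0) : Seminorm ℂ (GS E) :=
  gsSeminorms (Sum.inl h) + gsSeminorms (Sum.inr h)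

theorem le_seminorm_inl (h : ℝ≥0) (f : GS E) (x : E) :
    ‖f x‖ * Real.exp (h * ‖x‖) ≤ gsSeminorms (Sum.inl h) f :=
  le_ciSup (f.expDecay.bddAbove h) x

theorem le_seminorm_inr (h : ℝ≥0) (f : GS E) (x : E) :
    ‖𝓕 (f : E → ℂ) x‖ * Real.exp (h * ‖x‖) ≤ gsSeminorms (Sum.inr h) f :=
  le_ciSup (f.expDecay_fourier.bddAbove h) x

theorem seminorm_inl_le {h : ℝ≥0} {f : GS E} {C : ℝ}
    (H : ∀ x, ‖f x‖ * Real.exp (h * ‖x‖) ≤ C) : gsSeminorms (Sum.inl h) f ≤ C :=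
  ciSup_le H

theorem seminorm_inr_le {h : ℝ≥0} {f : GS E} {C : ℝ}
    (H : ∀ x, ‖𝓕 (f : E → ℂ) x‖ * Real.exp (h * ‖x‖) ≤ C) : gsSeminorms (Sum.inr h) f ≤ C :=
  ciSup_le H

theorem seminorm_inl_le_wnorm (h : ℝ≥0) (f : GS E) : gsSeminorms (Sum.inl h) f ≤ wnorm h f :=
  le_add_of_nonneg_right (apply_nonneg _ f)

theorem seminorm_inr_le_wnorm (h : ℝ≥0) (f : GS E) : gsSeminorms (Sum.inr h) f ≤ wnorm h f :=
  le_add_of_nonneg_left (apply_nonneg _ f)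

theorem norm_mul_exp_le_wnorm (h : ℝ≥0) (f : GS E) (x : E) :
    ‖f x‖ * Real.exp (h * ‖x‖) ≤ wnorm h f :=
  (le_seminorm_inl h f x).trans (seminorm_inl_le_wnorm h f)

theorem norm_fourier_mul_exp_le_wnorm (h : ℝ≥0) (f : GS E) (x : E) :
    ‖𝓕 (f : E → ℂ) x‖ * Real.exp (h * ‖x‖) ≤ wnorm h f :=
  (le_seminorm_inr h f x).trans (seminorm_inr_le_wnorm h f)

theorem norm_le_wnorm (h : ℝ≥0) (f : GS E) (x : E) :
    ‖f x‖ ≤ wnorm h f * Real.exp (-(h * ‖x‖)) := by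
  rw [Real.exp_neg, ← div_eq_mul_inv, le_div_iff₀ (Real.exp_pos _)]
  exact norm_mul_exp_le_wnorm h f x

theorem wnorm_le {h : ℝ≥0} {f : GS E} {C D : ℝ}
    (H : ∀ x, ‖f x‖ * Real.exp (h * ‖x‖) ≤ C)
    (H' : ∀ x, ‖𝓕 (f : E → ℂ) x‖ * Real.exp (h * ‖x‖) ≤ D) : wnorm h f ≤ C + D :=
  add_le_add (seminorm_inl_le H) (seminorm_inr_le H')

theorem seminorm_mono {h k : ℝ≥0} (hk : h ≤ k) (f : GS E) :
    gsSeminorms (Sum.inl h) f ≤ gsSeminorms (Sum.inl k) f ∧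
      gsSeminorms (Sum.inr h) f ≤ gsSeminorms (Sum.inr k) f := by
  have key : ∀ x : E, Real.exp (h * ‖x‖) ≤ Real.exp (k * ‖x‖) := fun x => by gcongr
  exact ⟨seminorm_inl_le fun x =>
      (mul_le_mul_of_nonneg_left (key x) (norm_nonneg _)).trans (le_seminorm_inl k f x),
    seminorm_inr_le fun x =>
      (mul_le_mul_of_nonneg_left (key x) (norm_nonneg _)).trans (le_seminorm_inr k f x)⟩

theorem wnorm_mono {h k : ℝ≥0} (hk : h ≤ k) (f : GS E) : wnorm h f ≤ wnorm k f :=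
  add_le_add (seminorm_mono hk f).1 (seminorm_mono hk f).2

theorem continuous_wnorm (h : ℝ≥0) : Continuous (wnorm (E := E) h) :=
  (withSeminorms.continuous_seminorm _).add (withSeminorms.continuous_seminorm _)

/-- Continuity bounds the functional by finitely many seminorms. Both families increase with the
weight, so the largest weight occurring dominates them all. -/
theorem exists_bound (a : GSDual E) :
    ∃ (k : ℝ≥0) (C : ℝ≥0), ∀ f, ‖a f‖ ≤ C * wnorm k f := by
  obtain ⟨s, C, -, hC⟩ := Seminorm.bound_of_continuous withSeminorms
    ((normSeminorm ℂ ℂ).comp a.toLinearMap) (continuous_norm.comp a.continuous)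
  let e : ℝ≥0 ⊕ ℝ≥0 → ℝ≥0 := Sum.elim id id
  refine ⟨s.sup e, C, fun f => (hC f).trans ?_⟩
  change (C : ℝ) * (s.sup gsSeminorms) f ≤ _
  refine mul_le_mul_of_nonneg_left ?_ C.2
  refine Seminorm.finset_sup_apply_le (apply_nonneg _ f) fun i hi => ?_
  have h1 : e i ≤ s.sup e := Finset.le_sup hi
  rcases i with h | h
  · exact (seminorm_mono h1 f).1.trans (seminorm_inl_le_wnorm _ f)
  · exact (seminorm_mono h1 f).2.trans (seminorm_inr_le_wnorm _ f)

theorem continuous_of_bound {F : Type*} [NormedAddCommGroup F] [NormedSpace ℂ F]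
    (L : GS E →ₗ[ℂ] F) (k : ℝ≥0) (C : ℝ) (hL : ∀ f, ‖L f‖ ≤ C * wnorm k f) : Continuous L := by
  refine continuous_of_continuousAt_zero L ?_
  rw [ContinuousAt, map_zero, tendsto_zero_iff_norm_tendsto_zero]
  refine squeeze_zero (fun _ => norm_nonneg _) hL ?_
  have := ((continuous_wnorm (E := E) k).const_mul C).tendsto 0
  simpa using this

theorem conj_conj (f : GS E) : f.conj.conj = f := by ext x; simp

theorem conj_add (f g : GS E) : (f + g).conj = f.conj + g.conj := by ext x; simp

theorem conj_smul (c : ℂ) (f : GS E) : (c • f).conj = conj c • f.conj := by ext x; simp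

theorem fourier_conj_apply (f : GS E) (x : E) :
    𝓕 (f.conj : E → ℂ) x = conj (𝓕 (f : E → ℂ) (-x)) := by
  change 𝓕 (fun x => conj (f x)) x = _
  rw [Real.fourier_eq', Real.fourier_eq', ← integral_conj]
  refine integral_congr_ae (Filter.Eventually.of_forall fun v => ?_)
  simp [← Complex.exp_conj, Complex.conj_ofNat]

theorem wnorm_conj_le (h : ℝ≥0) (f : GS E) : wnorm h f.conj ≤ wnorm h f := by
  refine wnorm_le (fun x => ?_) (fun x => ?_)
  · simpa using le_seminorm_inl h f x
  · rw [fourier_conj_apply, RCLike.norm_conj, ← norm_neg x]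
    exact le_seminorm_inr h f (-x)

theorem wnorm_conj (h : ℝ≥0) (f : GS E) : wnorm h f.conj = wnorm h f :=
  (wnorm_conj_le h f).antisymm (by simpa [conj_conj] using wnorm_conj_le h f.conj)

theorem continuous_fourier (f : GS E) : Continuous (𝓕 (f : E → ℂ)) :=
  VectorFourier.fourierIntegral_continuous Real.continuous_fourierChar
    (by exact continuous_inner) f.integrable

theorem fourier_fourier_apply (f : GS E) (x : E) :
    𝓕 (𝓕 (f : E → ℂ)) x = f (-x) := by
  have := f.integrable.fourierInv_fourier_eq (f.expDecay_fourier.integrable f.continuous_fourier)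
    (v := -x) f.continuous_coe.continuousAt
  rw [Real.fourierInv_eq_fourier_neg, neg_neg] at this
  exact this

theorem _root_.ExpDecay.comp_neg {E : Type} [NormedAddCommGroup E] {f : E → ℂ} (hf : ExpDecay f) :
    ExpDecay (fun x => f (-x)) := fun h hh => by
  obtain ⟨C, hC⟩ := hf h hh
  exact ⟨C, fun x => by simpa using hC (-x)⟩

/-- The Fourier transform as an element of the Gelfand–Shilov space. -/
noncomputable def ft (f : GS E) : GS E :=
  ⟨𝓕 (f : E → ℂ), f.continuous_fourier, f.expDecay_fourier, by
    rw [show 𝓕 (𝓕 (f : E → ℂ)) = fun x => f (-x) from funext f.fourier_fourier_apply]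
    exact f.expDecay.comp_neg⟩

/-- By Fourier inversion the transform exchanges the two summands of `wnorm`, up to a reflection
that the weights do not see. -/
theorem wnorm_ft_le (h : ℝ≥0) (f : GS E) : wnorm h f.ft ≤ wnorm h f := by
  refine (wnorm_le (C := gsSeminorms (Sum.inr h) f) (D := gsSeminorms (Sum.inl h) f)
    (fun x => ?_) (fun x => ?_)).trans_eq (add_comm _ _)
  · exact le_seminorm_inr h f x
  · change ‖𝓕 (𝓕 (f : E → ℂ)) x‖ * _ ≤ _
    rw [fourier_fourier_apply, ← norm_neg x]
    exact le_seminorm_inl h f (-x)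

/-- The function `w ↦ f (z - w)`. -/
def reflShift (f : GS E) (z : E) : E → ℂ := fun w => f (z - w)

theorem fourier_reflShift (f : GS E) (z w : E) :
    𝓕 (f.reflShift z) w = 𝐞 (-⟪z, w⟫_ℝ) * 𝓕 (f : E → ℂ) (-w) := by
  rw [Real.fourier_eq, Real.fourier_eq]
  rw [← integral_sub_left_eq_self _ volume z, ← integral_const_mul]
  refine integral_congr_ae (Filter.Eventually.of_forall fun v => ?_)
  simp only [reflShift, sub_sub_cancel, Circle.smul_def, smul_eq_mul, ← mul_assoc,
    ← Circle.coe_mul, ← AddChar.map_add_eq_mul]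
  congr 3
  simp [inner_sub_left]
  ring

theorem norm_fourier_reflShift (f : GS E) (z w : E) :
    ‖𝓕 (f.reflShift z) w‖ = ‖𝓕 (f : E → ℂ) (-w)‖ := by
  rw [fourier_reflShift, norm_mul, Circle.norm_coe, one_mul]

/-- The function `w ↦ f (z - w)` as an element of the Gelfand–Shilov space. -/
def rshift (f : GS E) (z : E) : GS E :=
  ⟨f.reflShift z, f.continuous_coe.comp (continuous_const.sub continuous_id), by
    intro h hh
    obtain ⟨C, hC⟩ := f.expDecay h hh
    refine ⟨C * Real.exp (h * ‖z‖), fun w => ?_⟩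
    calc ‖f (z - w)‖ * Real.exp (h * ‖w‖)
        ≤ ‖f (z - w)‖ * Real.exp (h * ‖z - w‖ + h * ‖z‖) := by
          gcongr
          have : ‖w‖ ≤ ‖z - w‖ + ‖z‖ := by
            simpa [norm_sub_rev] using norm_add_le (w - z) z
          nlinarith
      _ = ‖f (z - w)‖ * Real.exp (h * ‖z - w‖) * Real.exp (h * ‖z‖) := by
          rw [Real.exp_add, mul_assoc]
      _ ≤ C * Real.exp (h * ‖z‖) := by gcongr; exact hC _, by
    intro h hh
    obtain ⟨C, hC⟩ := f.expDecay_fourier h hh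
    refine ⟨C, fun w => ?_⟩
    rw [norm_fourier_reflShift, ← norm_neg w]
    exact hC (-w)⟩

@[simp] theorem rshift_apply (f : GS E) (z w : E) : f.rshift z w = f (z - w) := rfl

theorem fourier_rshift (f : GS E) (z w : E) :
    𝓕 (f.rshift z : E → ℂ) w = 𝐞 (-⟪z, w⟫_ℝ) * 𝓕 (f : E → ℂ) (-w) := fourier_reflShift f z w

theorem seminorm_inl_rshift_le (h : ℝ≥0) (f : GS E) (z : E) :
    gsSeminorms (Sum.inl h) (f.rshift z) ≤
      gsSeminorms (Sum.inl h) f * Real.exp (h * ‖z‖) := by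
  refine seminorm_inl_le fun w => ?_
  calc ‖f (z - w)‖ * Real.exp (h * ‖w‖)
      ≤ ‖f (z - w)‖ * Real.exp (h * ‖z - w‖ + h * ‖z‖) := by
        gcongr
        have : ‖w‖ ≤ ‖z - w‖ + ‖z‖ := by
          simpa [norm_sub_rev] using norm_add_le (w - z) z
        nlinarith [h.2]
    _ = ‖f (z - w)‖ * Real.exp (h * ‖z - w‖) * Real.exp (h * ‖z‖) := by
        rw [Real.exp_add, mul_assoc]
    _ ≤ gsSeminorms (Sum.inl h) f * Real.exp (h * ‖z‖) := by
        gcongr; exact le_seminorm_inl h f _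

theorem seminorm_inr_rshift_le (h : ℝ≥0) (f : GS E) (z : E) :
    gsSeminorms (Sum.inr h) (f.rshift z) ≤ gsSeminorms (Sum.inr h) f := by
  refine seminorm_inr_le fun w => ?_
  rw [fourier_rshift, norm_mul, Circle.norm_coe, one_mul, ← norm_neg w]
  exact le_seminorm_inr h f (-w)

/-- On the function side `‖w‖ ≤ ‖z - w‖ + ‖z‖` costs the exponential factor; on the Fourier side
translation only introduces a phase. Hence `z ↦ a (f.rshift z)` grows at most exponentially and is
integrable against any Gelfand–Shilov function. -/
theorem wnorm_rshift_le (h : ℝ≥0) (f : GS E) (z : E) :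
    wnorm h (f.rshift z) ≤ wnorm h f * Real.exp (h * ‖z‖) := by
  refine (add_le_add (seminorm_inl_rshift_le h f z) (seminorm_inr_rshift_le h f z)).trans ?_
  change _ ≤ (gsSeminorms (Sum.inl h) f + gsSeminorms (Sum.inr h) f) * _
  rw [add_mul]
  gcongr
  exact le_mul_of_one_le_right (apply_nonneg _ f) (Real.one_le_exp (by positivity))

/-- The reflection `x ↦ f (-x)`. -/
def refl (f : GS E) : GS E := f.rshift 0

@[simp] theorem refl_apply (f : GS E) (x : E) : f.refl x = f (-x) := by simp [refl]

theorem wnorm_refl_le (h : ℝ≥0) (f : GS E) : wnorm h f.refl ≤ wnorm h f := by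
  simpa [refl] using wnorm_rshift_le h f 0

end GS

/-! ### Fourier calculus and changes of variables. -/

section FourierLemmas

variable {E : Type} [NormedAddCommGroup E] [InnerProductSpace ℝ E] [FiniteDimensional ℝ E]
  [MeasurableSpace E] [BorelSpace E]

theorem fourierChar_conj (r : ℝ) : conj (𝐞 r : ℂ) = 𝐞 (-r) := by
  rw [AddChar.map_neg_eq_inv, Circle.coe_inv_eq_conj]

theorem fourierChar_add_coe (r s : ℝ) : (𝐞 (r + s) : ℂ) = 𝐞 r * 𝐞 s := by
  rw [AddChar.map_add_eq_mul, Circle.coe_mul]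

theorem integral_comp_add_smul {F : Type*} [NormedAddCommGroup F] [NormedSpace ℝ F]
    (f : E → F) (x : E) (c : ℝ) :
    ∫ t, f (x + c • t) = |(c ^ Module.finrank ℝ E)⁻¹| • ∫ t, f t := by
  rw [Measure.integral_comp_smul volume (fun t => f (x + t)) c, integral_add_left_eq_self]

theorem integrable_comp_add_smul {F : Type*} [NormedAddCommGroup F]
    {f : E → F} (hf : Integrable f) (x : E) {c : ℝ} (hc : c ≠ 0) :
    Integrable fun t => f (x + c • t) :=
  (hf.comp_add_left x).comp_smul hc

theorem fourier_eq_mul (f : E → ℂ) (w : E) :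
    𝓕 f w = ∫ v, 𝐞 (-⟪v, w⟫_ℝ) * f v := by
  simp only [Real.fourier_eq, Circle.smul_def, smul_eq_mul]

theorem fourier_comp_add_smul (f : E → ℂ) (x w : E) {c : ℝ} (hc : c ≠ 0) :
    𝓕 (fun t => f (x + c • t)) w =
      |(c ^ Module.finrank ℝ E)⁻¹| • (𝐞 (⟪x, c⁻¹ • w⟫_ℝ) * 𝓕 f (c⁻¹ • w)) := by
  rw [fourier_eq_mul, fourier_eq_mul, ← integral_const_mul, ← integral_comp_add_smul _ x c]
  refine integral_congr_ae (Filter.Eventually.of_forall fun t => ?_)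
  simp only [← mul_assoc, ← fourierChar_add_coe]
  congr 3
  simp only [inner_add_left, inner_smul_left, inner_smul_right]
  simp
  field_simp
  ring

theorem fourier_fourierChar_mul (f : E → ℂ) (x w : E) :
    𝓕 (fun t => 𝐞 (⟪x, t⟫_ℝ) * f t) w = 𝓕 f (w - x) := by
  rw [fourier_eq_mul, fourier_eq_mul]
  refine integral_congr_ae (Filter.Eventually.of_forall fun t => ?_)
  simp only [← mul_assoc, ← fourierChar_add_coe]
  congr 3
  rw [inner_sub_right, real_inner_comm t x]
  ring

theorem fourier_comp_neg (f : E → ℂ) (w : E) : 𝓕 (fun t => f (-t)) w = 𝓕 f (-w) := by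
  have := fourier_comp_add_smul f 0 w (c := -1) (by norm_num)
  simpa [abs_inv, abs_pow] using this

theorem integrable_fourierChar_mul {f : E → ℂ} (hf : Integrable f) (x : E) :
    Integrable fun t => 𝐞 (⟪x, t⟫_ℝ) * f t := by
  refine hf.norm.mono' (AEStronglyMeasurable.mul ?_ hf.1) (Filter.Eventually.of_forall fun t => ?_)
  · refine Continuous.aestronglyMeasurable ?_
    fun_prop
  · rw [norm_mul, Circle.norm_coe, one_mul]

theorem integral_fourier_mul_eq {f g : E → ℂ} (hf : Integrable f) (hg : Integrable g) :
    ∫ w, 𝓕 f w * g w = ∫ x, f x * 𝓕 g x := by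
  have := VectorFourier.integral_fourierIntegral_smul_eq_flip (μ := volume) (ν := volume)
    (L := innerₗ E) Real.continuous_fourierChar continuous_inner hf hg
  rw [flip_innerₗ] at this
  exact this

/-- The Fourier transform of a product is a convolution. -/
theorem fourier_mul_eq {u v : E → ℂ} (huc : Continuous u) (hu : Integrable u)
    (hu' : Integrable (𝓕 u)) (hv : Integrable v) (w : E) :
    𝓕 (fun t => u t * v t) w = ∫ η, 𝓕 u η * 𝓕 v (w - η) := by
  -- Inversion presents `u` itself as a Fourier transform, so that the transform can be moved onto
  -- the other factor by `integral_fourier_mul_eq`.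
  have h1 : ∀ t, u t = 𝓕 (fun η => 𝓕 u (-η)) t := fun t => by
    rw [fourier_comp_neg, ← Real.fourierInv_eq_fourier_neg, huc.fourierInv_fourier_eq hu hu']
  calc 𝓕 (fun t => u t * v t) w
      = ∫ t, 𝓕 (fun η => 𝓕 u (-η)) t * (𝐞 (⟪-w, t⟫_ℝ) * v t) := by
        rw [fourier_eq_mul]
        refine integral_congr_ae (Filter.Eventually.of_forall fun t => ?_)
        simp only [← h1]
        rw [inner_neg_left, real_inner_comm]
        ring
    _ = ∫ η, 𝓕 u (-η) * 𝓕 v (η - -w) := by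
        rw [integral_fourier_mul_eq hu'.comp_neg (integrable_fourierChar_mul hv _)]
        simp only [fourier_fourierChar_mul]
    _ = ∫ η, 𝓕 u η * 𝓕 v (w - η) := by
        rw [← integral_neg_eq_self]
        simp [sub_eq_add_neg, add_comm]

/-- The map `(x, t) ↦ (x + t/2, x - t/2)` has Jacobian of absolute value 1. It is carried out by
rescaling `t` and then `x`, with inverse constants, so that the integral of a convolution appears in
between. -/
theorem integral_integral_add_sub {A B : E → ℂ} (hA : Integrable A) (hB : Integrable B) :
    ∫ x, ∫ t, A (x + (2⁻¹ : ℝ) • t) * B (x - (2⁻¹ : ℝ) • t) = (∫ y, A y) * ∫ y, B y := by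
  have h1 : ∀ x : E, ∫ t, A (x + (2⁻¹ : ℝ) • t) * B (x - (2⁻¹ : ℝ) • t) =
      |((2⁻¹ : ℝ) ^ Module.finrank ℝ E)⁻¹| • ∫ s, A s * B ((2 : ℝ) • x - s) := fun x => by
    rw [← integral_comp_add_smul (fun s => A s * B ((2 : ℝ) • x - s)) x 2⁻¹]
    refine integral_congr_ae (Filter.Eventually.of_forall fun t => ?_)
    simp only [two_smul]
    congr 2
    abel
  simp only [h1]
  rw [integral_smul, Measure.integral_comp_smul volume (fun y => ∫ s, A s * B (y - s)) 2, smul_smul]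
  have h2 := integral_convolution (ContinuousLinearMap.mul ℂ ℂ) hA hB
  simp only [convolution, ContinuousLinearMap.mul_apply'] at h2
  rw [h2, ← abs_mul, ← mul_inv, ← mul_pow]
  norm_num

theorem integrable_exp_neg_norm : Integrable fun t : E => Real.exp (-‖t‖) := by
  set k : ℕ := Module.finrank ℝ E + 1 with hk
  have hI : Integrable (fun x : E => (1 + ‖x‖) ^ (-(k : ℝ))) :=
    integrable_one_add_norm (by rw [hk]; push_cast; linarith)
  refine (hI.const_mul (k.factorial * Real.exp 1)).mono'
    (by fun_prop) (Filter.Eventually.of_forall fun x => ?_)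
  have h1 : 0 < 1 + ‖x‖ := by positivity
  have h2 := Real.pow_div_factorial_le_exp (1 + ‖x‖) h1.le k
  have hfac : (0 : ℝ) < k.factorial := by exact_mod_cast k.factorial_pos
  rw [div_le_iff₀ hfac, Real.exp_add] at h2
  rw [Real.rpow_neg h1.le, Real.rpow_natCast, ← div_eq_mul_inv, le_div_iff₀ (by positivity),
    Real.norm_of_nonneg (Real.exp_pos _).le]
  calc Real.exp (-‖x‖) * (1 + ‖x‖) ^ k
      ≤ Real.exp (-‖x‖) * (Real.exp 1 * Real.exp ‖x‖ * k.factorial) := by gcongr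
    _ = (Real.exp (-‖x‖) * Real.exp ‖x‖) * (k.factorial * Real.exp 1) := by ring
    _ = k.factorial * Real.exp 1 := by rw [← Real.exp_add]; simp

end FourierLemmas

/-! ### The cross-Wigner transform of Gelfand–Shilov functions. -/

section Wigner

variable {E : Type} [NormedAddCommGroup E] [InnerProductSpace ℝ E] [FiniteDimensional ℝ E]
  [MeasurableSpace E] [BorelSpace E]

/-- The function `t ↦ f (x + t/2) conj (g (x - t/2))`. -/
noncomputable def wignerKernel (f g : E → ℂ) (x t : E) : ℂ :=
  f (x + (2⁻¹ : ℝ) • t) * conj (g (x - (2⁻¹ : ℝ) • t))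

theorem coe_fourierChar_neg_inner {E : Type} [NormedAddCommGroup E] [InnerProductSpace ℝ E]
    (x y : E) :
    (𝐞 (-⟪x, y⟫_ℝ) : ℂ) = Complex.exp (-(2 * π * Complex.I * (⟪x, y⟫_ℝ : ℝ))) := by
  rw [Real.fourierChar_apply]
  congr 1
  push_cast
  ring

theorem wigner_eq_fourier (f g : E → ℂ) (z : Phase E) :
    wigner f g z = 𝓕 (wignerKernel f g z.fst) z.snd := by
  rw [fourier_eq_mul]
  refine integral_congr_ae (Filter.Eventually.of_forall fun t => ?_)
  simp only [wignerKernel]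
  rw [real_inner_comm, coe_fourierChar_neg_inner, mul_comm]

theorem wigner_toLp (f g : E → ℂ) (x ω : E) :
    wigner f g (WithLp.toLp 2 (x, ω)) = 𝓕 (wignerKernel f g x) ω := wigner_eq_fourier f g _

theorem norm_add_half_add_norm_sub_half {E : Type} [NormedAddCommGroup E] [InnerProductSpace ℝ E]
    (x t : E) :
    2 * ‖x‖ ≤ ‖x + (2⁻¹ : ℝ) • t‖ + ‖x - (2⁻¹ : ℝ) • t‖ ∧
      ‖t‖ ≤ ‖x + (2⁻¹ : ℝ) • t‖ + ‖x - (2⁻¹ : ℝ) • t‖ := by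
  constructor
  · calc 2 * ‖x‖ = ‖(x + (2⁻¹ : ℝ) • t) + (x - (2⁻¹ : ℝ) • t)‖ := by
          rw [add_add_sub_cancel, ← two_smul ℝ, norm_smul]; norm_num
      _ ≤ _ := norm_add_le _ _
  · calc ‖t‖ = ‖(x + (2⁻¹ : ℝ) • t) - (x - (2⁻¹ : ℝ) • t)‖ := by
          rw [add_sub_sub_cancel, ← add_smul]; norm_num
      _ ≤ _ := norm_sub_le _ _

namespace GS

theorem continuous_wignerKernel (F G : GS E) :
    Continuous fun p : E × E => wignerKernel F G p.1 p.2 := by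
  have hF := F.continuous_coe
  have hG := G.continuous_coe
  unfold wignerKernel
  fun_prop

/-- The norms of the two arguments sum to at least `2‖x‖` and at least `‖t‖`. Of the weight `h + 1`,
the part `h` buys decay in `x`, and the extra unit buys the integrable factor `e^{-‖t‖}`. -/
theorem norm_wignerKernel_le (h : ℝ≥0) (F G : GS E) (x t : E) :
    ‖wignerKernel F G x t‖ ≤
      wnorm (h + 1) F * wnorm (h + 1) G * Real.exp (-(2 * h * ‖x‖)) * Real.exp (-‖t‖) := by
  rw [wignerKernel, norm_mul, RCLike.norm_conj]
  calc _ ≤ (wnorm (h + 1) F * Real.exp (-((h + 1 : ℝ≥0) * ‖x + (2⁻¹ : ℝ) • t‖))) *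
        (wnorm (h + 1) G * Real.exp (-((h + 1 : ℝ≥0) * ‖x - (2⁻¹ : ℝ) • t‖))) :=
        mul_le_mul (norm_le_wnorm _ _ _) (norm_le_wnorm _ _ _) (norm_nonneg _)
          (mul_nonneg (apply_nonneg _ _) (Real.exp_pos _).le)
    _ = wnorm (h + 1) F * wnorm (h + 1) G *
        Real.exp (-((h + 1 : ℝ≥0) * (‖x + (2⁻¹ : ℝ) • t‖ + ‖x - (2⁻¹ : ℝ) • t‖))) := by
        rw [mul_add, neg_add, Real.exp_add]; ring
    _ ≤ wnorm (h + 1) F * wnorm (h + 1) G * Real.exp (-(2 * h * ‖x‖) + -‖t‖) := by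
        refine mul_le_mul_of_nonneg_left (Real.exp_le_exp.2 ?_)
          (mul_nonneg (apply_nonneg _ _) (apply_nonneg _ _))
        obtain ⟨h1, h2⟩ := norm_add_half_add_norm_sub_half x t
        push_cast
        nlinarith [h.2, mul_le_mul_of_nonneg_left h1 h.2]
    _ = _ := by rw [Real.exp_add]; ring

theorem norm_wignerKernel_le' (F G : GS E) (x t : E) :
    ‖wignerKernel F G x t‖ ≤ wnorm 1 F * wnorm 1 G * Real.exp (-‖t‖) := by
  simpa using norm_wignerKernel_le 0 F G x t

theorem integrable_wignerKernel (F G : GS E) (x : E) : Integrable (wignerKernel F G x) :=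
  (integrable_exp_neg_norm.const_mul _).mono'
    ((continuous_wignerKernel F G).comp (Continuous.prodMk_right x)).aestronglyMeasurable
    (Filter.Eventually.of_forall (norm_wignerKernel_le' F G x))

theorem continuous_wigner (F G : GS E) : Continuous (wigner F G) := by
  have h1 := continuous_wignerKernel F G
  have h2 : ∀ z : Phase E, wigner F G z =
      ∫ t, 𝐞 (-⟪t, z.snd⟫_ℝ) * wignerKernel F G z.fst t := fun z => by
    rw [wigner_eq_fourier, fourier_eq_mul]
  rw [funext h2]
  have hfst : Continuous fun z : Phase E => z.fst := WithLp.continuous_fst 2 E E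
  have hsnd : Continuous fun z : Phase E => z.snd := WithLp.continuous_snd 2 E E
  refine continuous_of_dominated (bound := fun t => wnorm 1 F * wnorm 1 G * Real.exp (-‖t‖))
    (fun z => ?_) (fun z => ?_) (integrable_exp_neg_norm.const_mul _) ?_
  · refine Continuous.aestronglyMeasurable (Continuous.mul (by fun_prop) ?_)
    exact h1.comp (Continuous.prodMk_right z.fst)
  · refine Filter.Eventually.of_forall fun t => ?_
    rw [norm_mul, Circle.norm_coe, one_mul]
    exact norm_wignerKernel_le' F G z.fst t
  · refine Filter.Eventually.of_forall fun t => Continuous.mul (by fun_prop) ?_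
    exact h1.comp (hfst.prodMk continuous_const)

variable (E) in
/-- The integral of `e^{-|t|}`. -/
noncomputable def expIntegral : ℝ := ∫ t : E, Real.exp (-‖t‖)

theorem expIntegral_nonneg : 0 ≤ expIntegral E := integral_nonneg fun _ => (Real.exp_pos _).le

theorem norm_wigner_le_fst (h : ℝ≥0) (F G : GS E) (z : Phase E) :
    ‖wigner F G z‖ ≤ expIntegral E * wnorm (h + 1) F * wnorm (h + 1) G *
      Real.exp (-(2 * h * ‖z.fst‖)) := by
  rw [wigner_eq_fourier, fourier_eq_mul]
  refine (norm_integral_le_of_norm_le (integrable_exp_neg_norm.const_mul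
    (wnorm (h + 1) F * wnorm (h + 1) G * Real.exp (-(2 * h * ‖z.fst‖))))
    (Filter.Eventually.of_forall fun t => ?_)).trans_eq ?_
  · rw [norm_mul, Circle.norm_coe, one_mul]
    exact norm_wignerKernel_le h F G z.fst t
  · rw [integral_const_mul, ← expIntegral]
    ring

/-- The transform of the product defining the kernel is the convolution of the transforms of its
factors, which is again a Wigner integral after an affine substitution. This turns decay in position
into decay in frequency. -/
theorem wigner_eq_wigner_ft (F G : GS E) (z : Phase E) :
    wigner F G z = wigner F.ft G.ft (WithLp.toLp 2 (z.snd, -z.fst)) := by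
  obtain ⟨x, ω⟩ := z
  set m := Module.finrank ℝ E with hm
  have hu : ∀ η, 𝓕 (fun t => F (x + (2⁻¹ : ℝ) • t)) η =
      |((2⁻¹ : ℝ) ^ m)⁻¹| • (𝐞 (2 * ⟪x, η⟫_ℝ) * F.ft ((2 : ℝ) • η)) := fun η => by
    rw [fourier_comp_add_smul F x η (by norm_num : (2⁻¹ : ℝ) ≠ 0), inv_inv, inner_smul_right]
    rfl
  have hv : ∀ η, 𝓕 (fun t => conj (G (x - (2⁻¹ : ℝ) • t))) η =
      |((2⁻¹ : ℝ) ^ m)⁻¹| • (𝐞 (-(2 * ⟪x, η⟫_ℝ)) * conj (G.ft ((2 : ℝ) • η))) := fun η => by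
    have := fourier_comp_add_smul G.conj x η (by norm_num : (-2⁻¹ : ℝ) ≠ 0)
    rw [fourier_conj_apply] at this
    simp only [conj_apply, neg_smul, ← sub_eq_add_neg] at this
    rw [this, abs_inv, abs_inv, abs_pow, abs_pow, abs_neg, inv_neg, inv_inv, neg_smul, neg_neg,
      inner_neg_right, inner_smul_right]
    rfl
  have hui : Integrable (𝓕 fun t => F (x + (2⁻¹ : ℝ) • t)) := by
    have := integrable_fourierChar_mul
      (F.ft.integrable.comp_smul (two_ne_zero' ℝ)) ((2 : ℝ) • x)
    simp only [inner_smul_left, conj_trivial] at this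
    rw [funext hu]
    exact this.smul (|((2⁻¹ : ℝ) ^ m)⁻¹| : ℝ)
  have hvi : Integrable fun t => conj (G (x - (2⁻¹ : ℝ) • t)) := by
    have := integrable_comp_add_smul G.conj.integrable x (by norm_num : (-2⁻¹ : ℝ) ≠ 0)
    simpa only [conj_apply, neg_smul, ← sub_eq_add_neg] using this
  rw [wigner_eq_fourier]
  change 𝓕 (fun t => F (x + (2⁻¹ : ℝ) • t) * conj (G (x - (2⁻¹ : ℝ) • t))) ω = _
  rw [fourier_mul_eq (u := fun t => F (x + (2⁻¹ : ℝ) • t)) (F.continuous_coe.comp (by fun_prop))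
    (integrable_comp_add_smul F.integrable x (by norm_num)) hui hvi]
  rw [wigner_eq_fourier, fourier_eq_mul]
  set f : E → ℂ := fun η => 𝐞 (2 * ⟪x, η⟫_ℝ) * F.ft ((2 : ℝ) • η) *
    (𝐞 (-(2 * ⟪x, ω - η⟫_ℝ)) * conj (G.ft ((2 : ℝ) • (ω - η)))) with hf
  have h1 : ∫ η, 𝓕 (fun t => F (x + (2⁻¹ : ℝ) • t)) η *
      𝓕 (fun t => conj (G (x - (2⁻¹ : ℝ) • t))) (ω - η) =
      |((4⁻¹ : ℝ) ^ m)⁻¹| • ∫ η, f η := by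
    rw [← integral_smul]
    refine integral_congr_ae (Filter.Eventually.of_forall fun η => ?_)
    simp only [hu, hv, hf]
    rw [smul_mul_smul_comm, ← abs_mul, ← mul_inv, ← mul_pow]
    norm_num
  -- Substituting `η = ω/2 + t/4` makes the doubled arguments `ω ± t/2`, and its Jacobian absorbs
  -- the constant `4 ^ m` left by the two dilations.
  have h2 := integral_comp_add_smul f ((2⁻¹ : ℝ) • ω) (4⁻¹ : ℝ)
  rw [h1, hm, ← h2]
  refine integral_congr_ae (Filter.Eventually.of_forall fun t => ?_)
  have e1 : (2 : ℝ) • ((2⁻¹ : ℝ) • ω + (4⁻¹ : ℝ) • t) = ω + (2⁻¹ : ℝ) • t := by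
    module
  have e2 : (2 : ℝ) • (ω - ((2⁻¹ : ℝ) • ω + (4⁻¹ : ℝ) • t)) = ω - (2⁻¹ : ℝ) • t := by
    module
  have e3 : -⟪t, -x⟫_ℝ = 2 * ⟪x, (2⁻¹ : ℝ) • ω + (4⁻¹ : ℝ) • t⟫_ℝ +
      -(2 * ⟪x, ω - ((2⁻¹ : ℝ) • ω + (4⁻¹ : ℝ) • t)⟫_ℝ) := by
    simp only [inner_sub_right, inner_add_right, inner_smul_right, inner_neg_right,
      real_inner_comm t x]
    ring
  simp only [hf, e1, e2, wignerKernel, WithLp.toLp_fst, WithLp.toLp_snd]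
  rw [e3, fourierChar_add_coe]
  ring

theorem norm_wigner_le_snd (h : ℝ≥0) (F G : GS E) (z : Phase E) :
    ‖wigner F G z‖ ≤ expIntegral E * wnorm (h + 1) F * wnorm (h + 1) G *
      Real.exp (-(2 * h * ‖z.snd‖)) := by
  rw [wigner_eq_wigner_ft]
  refine (norm_wigner_le_fst h _ _ _).trans ?_
  have h1 : expIntegral E * wnorm (h + 1) F.ft ≤ expIntegral E * wnorm (h + 1) F :=
    mul_le_mul_of_nonneg_left (wnorm_ft_le _ _) expIntegral_nonneg
  exact mul_le_mul_of_nonneg_right (mul_le_mul h1 (wnorm_ft_le _ _) (apply_nonneg _ _)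
    (mul_nonneg expIntegral_nonneg (apply_nonneg _ _))) (Real.exp_pos _).le

theorem _root_.norm_phase_le {E : Type} [NormedAddCommGroup E] (z : Phase E) :
    ‖z‖ ≤ ‖z.fst‖ + ‖z.snd‖ := by
  refine abs_le_of_sq_le_sq' ?_ (by positivity) |>.2
  rw [WithLp.prod_norm_sq_eq_of_L2]
  nlinarith [norm_nonneg z.fst, norm_nonneg z.snd]

/-- The larger of `‖x‖` and `‖ω‖` is at least half their sum, so the better of the two one-sided
bounds suffices. -/
theorem norm_wigner_le_exp_add (h : ℝ≥0) (F G : GS E) (z : Phase E) :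
    ‖wigner F G z‖ ≤ expIntegral E * wnorm (h + 1) F * wnorm (h + 1) G *
      Real.exp (-(h * (‖z.fst‖ + ‖z.snd‖))) := by
  have hD : 0 ≤ expIntegral E * wnorm (h + 1) F * wnorm (h + 1) G :=
    mul_nonneg (mul_nonneg expIntegral_nonneg (apply_nonneg _ _)) (apply_nonneg _ _)
  have hh : (0 : ℝ) ≤ h := h.2
  rcases le_total ‖z.fst‖ ‖z.snd‖ with hz | hz
  · refine (norm_wigner_le_snd h F G z).trans (mul_le_mul_of_nonneg_left ?_ hD)
    exact Real.exp_le_exp.2 (by nlinarith [mul_le_mul_of_nonneg_left hz hh])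
  · refine (norm_wigner_le_fst h F G z).trans (mul_le_mul_of_nonneg_left ?_ hD)
    exact Real.exp_le_exp.2 (by nlinarith [mul_le_mul_of_nonneg_left hz hh])

theorem norm_wigner_mul_exp_le (h : ℝ≥0) (F G : GS E) (z : Phase E) :
    ‖wigner F G z‖ * Real.exp (h * ‖z‖) ≤
      expIntegral E * wnorm (h + 1) F * wnorm (h + 1) G := by
  have hD : 0 ≤ expIntegral E * wnorm (h + 1) F * wnorm (h + 1) G :=
    mul_nonneg (mul_nonneg expIntegral_nonneg (apply_nonneg _ _)) (apply_nonneg _ _)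
  rw [← le_div_iff₀ (Real.exp_pos _), div_eq_mul_inv, ← Real.exp_neg]
  refine (norm_wigner_le_exp_add h F G z).trans (mul_le_mul_of_nonneg_left ?_ hD)
  have := norm_phase_le z
  gcongr

theorem expDecay_wigner (F G : GS E) : ExpDecay (wigner F G) := fun h hh =>
  ⟨_, norm_wigner_mul_exp_le ⟨h, hh.le⟩ F G⟩

theorem integrable_wigner (F G : GS E) : Integrable (wigner F G) :=
  (expDecay_wigner F G).integrable (continuous_wigner F G)

theorem _root_.integral_phase {f : Phase E → ℂ} (hf : Integrable f) :
    ∫ z, f z = ∫ x, ∫ ω, f (WithLp.toLp 2 (x, ω)) := by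
  have h1 := WithLp.volume_preserving_toLp E E
  have h2 : MeasurableEmbedding (WithLp.toLp 2 : E × E → Phase E) :=
    (MeasurableEquiv.toLp 2 (E × E)).measurableEmbedding
  rw [← h1.integral_comp h2]
  exact integral_prod _ ((h1.integrable_comp_emb h2).2 hf)

theorem fourier_wignerKernel_integrable (F G : GS E) (x : E) :
    Integrable (𝓕 (wignerKernel F G x)) := by
  have h1 : ∀ ω, 𝓕 (wignerKernel F G x) ω = wigner F G (WithLp.toLp 2 (x, ω)) :=
    fun ω => (wigner_toLp _ _ _ _).symm
  rw [funext h1]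
  have hc : Continuous fun ω : E => (WithLp.toLp 2 (x, ω) : Phase E) := by fun_prop
  refine (integrable_exp_neg_norm.const_mul
    (expIntegral E * wnorm (1 + 1) F * wnorm (1 + 1) G)).mono'
    ((continuous_wigner F G).comp hc).aestronglyMeasurable
    (Filter.Eventually.of_forall fun ω => ?_)
  refine (norm_wigner_le_exp_add 1 F G _).trans (mul_le_mul_of_nonneg_left ?_
    (mul_nonneg (mul_nonneg expIntegral_nonneg (apply_nonneg _ _)) (apply_nonneg _ _)))
  refine Real.exp_le_exp.2 ?_
  simp

theorem fourier_fourier_wignerKernel (F G : GS E) (x t : E) :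
    𝓕 (𝓕 (wignerKernel F G x)) t = wignerKernel F G x (-t) := by
  have hc : Continuous (wignerKernel F G x) :=
    (continuous_wignerKernel F G).comp (Continuous.prodMk_right x)
  have := (integrable_wignerKernel F G x).fourierInv_fourier_eq
    (fourier_wignerKernel_integrable F G x) (v := -t) hc.continuousAt
  rwa [Real.fourierInv_eq_fourier_neg, neg_neg] at this

/-- Integrating over `ω` first undoes the transform of the kernel by inversion. What remains is an
integral over `x`, which the rescaling `x = s/2` turns back into a Wigner transform. -/
theorem fourier_wigner (F G : GS E) (z : Phase E) :
    𝓕 (wigner F G) z = |((2 : ℝ) ^ Module.finrank ℝ E)⁻¹| •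
      wigner F G.refl (WithLp.toLp 2 (-(2⁻¹ : ℝ) • z.snd, (2⁻¹ : ℝ) • z.fst)) := by
  obtain ⟨ξ, η⟩ := z
  have hI : Integrable fun v : Phase E => 𝐞 (-⟪v, WithLp.toLp 2 (ξ, η)⟫_ℝ) * wigner F G v := by
    have := integrable_fourierChar_mul (integrable_wigner F G) (-WithLp.toLp 2 (ξ, η))
    simpa only [inner_neg_left, real_inner_comm] using this
  rw [fourier_eq_mul, integral_phase hI]
  have h1 : ∀ x : E, ∫ ω, 𝐞 (-⟪(WithLp.toLp 2 (x, ω) : Phase E), WithLp.toLp 2 (ξ, η)⟫_ℝ) *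
      wigner F G (WithLp.toLp 2 (x, ω)) = 𝐞 (-⟪x, ξ⟫_ℝ) * wignerKernel F G x (-η) := fun x => by
    rw [← fourier_fourier_wignerKernel, fourier_eq_mul, ← integral_const_mul]
    refine integral_congr_ae (Filter.Eventually.of_forall fun ω => ?_)
    simp only [WithLp.prod_inner_apply, neg_add, fourierChar_add_coe, wigner_toLp, mul_assoc]
  simp only [h1]
  rw [wigner_toLp, fourier_eq_mul]
  set f : E → ℂ := fun x => 𝐞 (-⟪x, ξ⟫_ℝ) * wignerKernel F G x (-η) with hf
  have h2 : ∫ s, 𝐞 (-⟪s, (2⁻¹ : ℝ) • ξ⟫_ℝ) * wignerKernel F G.refl (-(2⁻¹ : ℝ) • η) s =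
      ∫ s, f (0 + (2⁻¹ : ℝ) • s) := by
    refine integral_congr_ae (Filter.Eventually.of_forall fun s => ?_)
    have e1 : (2⁻¹ : ℝ) • s + (2⁻¹ : ℝ) • -η = -(2⁻¹ : ℝ) • η + (2⁻¹ : ℝ) • s := by module
    have e2 : (2⁻¹ : ℝ) • s - (2⁻¹ : ℝ) • -η = -(-(2⁻¹ : ℝ) • η - (2⁻¹ : ℝ) • s) := by module
    simp only [hf, wignerKernel, zero_add, refl_apply, e1, e2, inner_smul_left, inner_smul_right,
      conj_trivial]
  refine Eq.trans ?_ (congrArg _ h2.symm)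
  rw [integral_comp_add_smul, smul_smul, ← abs_mul, ← mul_inv, ← mul_pow]
  norm_num

theorem norm_fourier_wigner_mul_exp_le (h : ℝ≥0) (F G : GS E) (z : Phase E) :
    ‖𝓕 (wigner F G) z‖ * Real.exp (h * ‖z‖) ≤
      expIntegral E * wnorm (2 * h + 1) F * wnorm (2 * h + 1) G := by
  have h1 : ‖(WithLp.toLp 2 (-(2⁻¹ : ℝ) • z.snd, (2⁻¹ : ℝ) • z.fst) : Phase E)‖ = 2⁻¹ * ‖z‖ := by
    rw [← sq_eq_sq₀ (norm_nonneg _) (by positivity), mul_pow, WithLp.prod_norm_sq_eq_of_L2,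
      WithLp.prod_norm_sq_eq_of_L2]
    simp only [WithLp.toLp_fst, WithLp.toLp_snd, norm_smul, mul_pow, norm_neg]
    norm_num
    ring
  -- The phase-space point has norm `‖z‖ / 2`, so the weight must be doubled.
  have h2 := norm_wigner_mul_exp_le (2 * h) F G.refl
    (WithLp.toLp 2 (-(2⁻¹ : ℝ) • z.snd, (2⁻¹ : ℝ) • z.fst))
  rw [h1] at h2
  have h3 : ((2 * h : ℝ≥0) : ℝ) * (2⁻¹ * ‖z‖) = h * ‖z‖ := by push_cast; ring
  rw [h3] at h2
  rw [fourier_wigner, norm_smul, Real.norm_eq_abs, abs_abs, mul_assoc]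
  have h4 : |((2 : ℝ) ^ Module.finrank ℝ E)⁻¹| ≤ 1 := by
    rw [abs_of_nonneg (by positivity)]
    exact inv_le_one_of_one_le₀ (one_le_pow₀ one_le_two)
  refine (mul_le_of_le_one_left (by positivity) h4).trans (h2.trans ?_)
  exact mul_le_mul_of_nonneg_left (wnorm_refl_le _ _)
    (mul_nonneg expIntegral_nonneg (apply_nonneg _ _))

/-- The cross-Wigner transform of two Gelfand–Shilov functions. -/
noncomputable def wig (F G : GS E) : GS (Phase E) :=
  ⟨wigner F G, continuous_wigner F G, expDecay_wigner F G, fun h hh =>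
    ⟨_, norm_fourier_wigner_mul_exp_le ⟨h, hh.le⟩ F G⟩⟩

@[simp] theorem wig_apply (F G : GS E) (z : Phase E) : wig F G z = wigner F G z := rfl

theorem wnorm_wig_le (h : ℝ≥0) (F G : GS E) :
    wnorm h (wig F G) ≤ 2 * expIntegral E * wnorm (2 * h + 1) F * wnorm (2 * h + 1) G := by
  have hk : h + 1 ≤ 2 * h + 1 := by
    gcongr
    rw [two_mul]
    exact le_add_of_nonneg_left h.2
  refine (wnorm_le (D := expIntegral E * wnorm (2 * h + 1) F * wnorm (2 * h + 1) G)
    (C := expIntegral E * wnorm (2 * h + 1) F * wnorm (2 * h + 1) G) (fun z => ?_)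
    (norm_fourier_wigner_mul_exp_le h F G)).trans_eq (by ring)
  refine (norm_wigner_mul_exp_le h F G z).trans ?_
  exact mul_le_mul (mul_le_mul_of_nonneg_left (wnorm_mono hk F) expIntegral_nonneg)
    (wnorm_mono hk G) (apply_nonneg _ _) (mul_nonneg expIntegral_nonneg (apply_nonneg _ _))

end GS
end Wigner

/-! ### Moyal's identity and sesquilinearity of the Wigner transform. -/

section Moyal

variable {E : Type} [NormedAddCommGroup E] [InnerProductSpace ℝ E] [FiniteDimensional ℝ E]
  [MeasurableSpace E] [BorelSpace E]

namespace GS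

theorem norm_le_wnorm_zero (f : GS E) (x : E) : ‖f x‖ ≤ wnorm 0 f := by
  simpa using norm_mul_exp_le_wnorm 0 f x

theorem integrable_fourierChar_mul_shift_mul (f g : GS E) (x ω : E) :
    Integrable fun t => (𝐞 ⟪ω, t⟫_ℝ : ℂ) * f (t - x) * g t := by
  have hf := f.continuous_coe
  have hg := g.continuous_coe
  refine (g.integrable.norm.const_mul (wnorm 0 f)).mono'
    (Continuous.aestronglyMeasurable (by fun_prop)) (Filter.Eventually.of_forall fun t => ?_)
  rw [norm_mul, norm_mul, Circle.norm_coe, one_mul]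
  exact mul_le_mul_of_nonneg_right (norm_le_wnorm_zero f _) (norm_nonneg _)

theorem stft_eq (f : GS E) (g : GS E) (z : Phase E) :
    stft g f z = ∫ t, conj ((𝐞 ⟪z.snd, t⟫_ℝ : ℂ) * g (t - z.fst)) * f t := by
  refine integral_congr_ae (Filter.Eventually.of_forall fun t => ?_)
  simp only [freqShift, timeShift, Real.fourierChar_apply]
  rw [mul_comm]
  congr 4
  push_cast
  ring

/-- Moyal's identity for the Wigner transforms of a pair and of a time-frequency shifted pair. -/
theorem integral_wigner_mul_wigner_sub (F G φ ψ : GS E) (w : Phase E) :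
    ∫ z, wigner F G z * wigner ψ φ (z - w) = stft φ F w * conj (stft ψ G w) := by
  obtain ⟨x₀, ω₀⟩ := w
  have hI : Integrable fun z => wigner F G z * wigner ψ φ (z - WithLp.toLp 2 (x₀, ω₀)) := by
    have hc := (wig F G).continuous_coe
    have hc' := (wig ψ φ).continuous_coe
    refine ((wig F G).integrable.norm.mul_const (wnorm 0 (wig ψ φ))).mono'
      (Continuous.aestronglyMeasurable ?_) (Filter.Eventually.of_forall fun t => ?_)
    · exact hc.mul (hc'.comp (continuous_id.sub continuous_const))
    · rw [norm_mul]
      exact mul_le_mul_of_nonneg_left (norm_le_wnorm_zero (wig ψ φ) _) (norm_nonneg _)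
  -- `A` and `B` are the integrands of `conj (V_ψ G)` and `V_φ F`, so `integral_integral_add_sub`
  -- reduces the identity to one between integrands in `(x, t)`.
  set A : E → ℂ := fun t => (𝐞 ⟪ω₀, t⟫_ℝ : ℂ) * ψ (t - x₀) * G.conj t with hA
  set B : E → ℂ := fun t => conj ((𝐞 ⟪ω₀, t⟫_ℝ : ℂ) * φ (t - x₀)) * F t with hB
  have hAi : Integrable A := integrable_fourierChar_mul_shift_mul ψ G.conj x₀ ω₀
  have hBi : Integrable B := by
    have := integrable_fourierChar_mul_shift_mul φ.conj F x₀ (-ω₀)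
    simpa only [hB, map_mul, fourierChar_conj, inner_neg_left, conj_apply] using this
  have hBs : stft φ F (WithLp.toLp 2 (x₀, ω₀)) = ∫ t, B t := stft_eq _ _ _
  have hAs : conj (stft ψ G (WithLp.toLp 2 (x₀, ω₀))) = ∫ t, A t := by
    rw [stft_eq, ← integral_conj]
    refine integral_congr_ae (Filter.Eventually.of_forall fun t => ?_)
    simp [hA]
  rw [integral_phase hI, hAs, hBs, mul_comm, ← integral_integral_add_sub hAi hBi]
  refine integral_congr_ae (Filter.Eventually.of_forall fun x => ?_)
  -- For fixed `x`, the frequency shift is a modulation of the kernel. Moving the outer transform to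
  -- the other factor then leaves a double transform, which inversion removes.
  have h1 : ∀ ω : E, wigner F G (WithLp.toLp 2 (x, ω)) *
      wigner ψ φ (WithLp.toLp 2 (x, ω) - WithLp.toLp 2 (x₀, ω₀)) =
      𝓕 (fun t => 𝐞 (⟪ω₀, t⟫_ℝ) * wignerKernel ψ φ (x - x₀) t) ω *
        𝓕 (wignerKernel F G x) ω := fun ω => by
    rw [fourier_fourierChar_mul, wigner_toLp, mul_comm]
    congr 1
    exact wigner_toLp _ _ _ _
  simp only [h1]
  rw [integral_fourier_mul_eq (integrable_fourierChar_mul (integrable_wignerKernel ψ φ _) _)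
    (fourier_wignerKernel_integrable F G x)]
  refine integral_congr_ae (Filter.Eventually.of_forall fun t => ?_)
  simp only [fourier_fourier_wignerKernel]
  -- Since `t = (x + t/2) - (x - t/2)`, the modulation splits into the phases of `A` and `B`.
  have e : ⟪ω₀, t⟫_ℝ = ⟪ω₀, x + (2⁻¹ : ℝ) • t⟫_ℝ + -⟪ω₀, x - (2⁻¹ : ℝ) • t⟫_ℝ := by
    rw [inner_add_right, inner_sub_right, inner_smul_right]
    ring
  simp only [hA, hB, wignerKernel, smul_neg, sub_neg_eq_add, ← sub_eq_add_neg, map_mul,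
    fourierChar_conj, conj_apply]
  rw [e, fourierChar_add_coe, sub_add_eq_add_sub, sub_right_comm]
  ring

theorem _root_.fourier_add_of_integrable {u v : E → ℂ} (hu : Integrable u) (hv : Integrable v)
    (w : E) : 𝓕 (fun t => u t + v t) w = 𝓕 u w + 𝓕 v w := by
  simp only [Real.fourier_eq, smul_add]
  exact integral_add ((Real.fourierIntegral_convergent_iff w).2 hu)
    ((Real.fourierIntegral_convergent_iff w).2 hv)

theorem _root_.fourier_const_mul (c : ℂ) (u : E → ℂ) (w : E) :
    𝓕 (fun t => c * u t) w = c * 𝓕 u w := by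
  simp only [fourier_eq_mul, mul_left_comm _ c]
  exact integral_const_mul _ _

theorem wig_add_left (F F' G : GS E) : wig (F + F') G = wig F G + wig F' G := by
  ext z
  simp only [wig_apply, add_apply, wigner_eq_fourier]
  rw [← fourier_add_of_integrable (integrable_wignerKernel F G _) (integrable_wignerKernel F' G _)]
  refine congrArg (fun u : E → ℂ => 𝓕 u z.snd) (funext fun t => ?_)
  exact add_mul _ _ _

theorem wig_smul_left (c : ℂ) (F G : GS E) : wig (c • F) G = c • wig F G := by
  ext z
  simp only [wig_apply, smul_apply, wigner_eq_fourier]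
  rw [← fourier_const_mul]
  refine congrArg (fun u : E → ℂ => 𝓕 u z.snd) (funext fun t => ?_)
  exact mul_assoc _ _ _

theorem wig_add_right (F G G' : GS E) : wig F (G + G') = wig F G + wig F G' := by
  ext z
  simp only [wig_apply, add_apply, wigner_eq_fourier]
  rw [← fourier_add_of_integrable (integrable_wignerKernel F G _) (integrable_wignerKernel F G' _)]
  refine congrArg (fun u : E → ℂ => 𝓕 u z.snd) (funext fun t => ?_)
  simp only [wignerKernel, add_apply, map_add]
  ring

theorem wig_smul_right (c : ℂ) (F G : GS E) : wig F (c • G) = conj c • wig F G := by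
  ext z
  simp only [wig_apply, smul_apply, wigner_eq_fourier]
  rw [← fourier_const_mul]
  refine congrArg (fun u : E → ℂ => 𝓕 u z.snd) (funext fun t => ?_)
  simp only [wignerKernel, smul_apply, map_mul]
  ring

end GS

end Moyal

/-! ### Convolution of a functional with a test function. -/

section Convolution

variable {E : Type} [NormedAddCommGroup E] [InnerProductSpace ℝ E] [FiniteDimensional ℝ E]
  [MeasurableSpace E] [BorelSpace E]

namespace GS

theorem fourier_sub_apply (f g : GS E) (x : E) :
    𝓕 ((f - g : GS E) : E → ℂ) x = 𝓕 (f : E → ℂ) x - 𝓕 (g : E → ℂ) x :=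
  congrFun (GS.fourier.map_sub f g) x

theorem norm_le_expIntegral_mul (f : GS E) (x : E) :
    ‖f x‖ ≤ gsSeminorms (Sum.inr 1) f * expIntegral E := by
  have h := fourier_fourier_apply f (-x)
  rw [neg_neg] at h
  rw [← h, fourier_eq_mul, expIntegral, ← integral_const_mul]
  refine norm_integral_le_of_norm_le (integrable_exp_neg_norm.const_mul _)
    (Filter.Eventually.of_forall fun t => ?_)
  rw [norm_mul, Circle.norm_coe, one_mul, Real.exp_neg, ← div_eq_mul_inv,
    le_div_iff₀ (Real.exp_pos _)]
  simpa using le_seminorm_inr 1 f t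

/-- Interpolation: the square of the weighted modulus is the modulus with doubled weight times the
plain modulus, and inversion bounds the latter by a Fourier-side seminorm. Smallness on the Fourier
side thus passes to the function side. -/
theorem seminorm_inl_le_sqrt (h : ℝ≥0) (f : GS E) :
    gsSeminorms (Sum.inl h) f ≤
      √(gsSeminorms (Sum.inl (2 * h)) f * (gsSeminorms (Sum.inr 1) f * expIntegral E)) := by
  refine seminorm_inl_le fun x => Real.le_sqrt_of_sq_le ?_
  calc (‖f x‖ * Real.exp (h * ‖x‖)) ^ 2
      = (‖f x‖ * Real.exp ((2 * h : ℝ≥0) * ‖x‖)) * ‖f x‖ := by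
        rw [mul_pow, ← Real.exp_nat_mul]
        push_cast
        rw [mul_assoc (2 : ℝ)]
        ring
    _ ≤ _ := mul_le_mul (le_seminorm_inl _ f x) (norm_le_expIntegral_mul f x) (norm_nonneg _)
        (apply_nonneg _ _)

theorem norm_fourierChar_sub_le (r s : ℝ) : ‖(𝐞 r : ℂ) - 𝐞 s‖ ≤ 2 * π * |r - s| := by
  have h1 : (𝐞 r : ℂ) - 𝐞 s = 𝐞 s * (Complex.exp (Complex.I * (2 * π * (r - s) : ℝ)) - 1) := by
    have : (𝐞 r : ℂ) = 𝐞 s * 𝐞 (r - s) := by rw [← fourierChar_add_coe]; ring_nf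
    rw [this, Real.fourierChar_apply (r - s)]
    ring_nf
  rw [h1, norm_mul, Circle.norm_coe, one_mul]
  refine (Real.norm_exp_I_mul_ofReal_sub_one_le).trans_eq ?_
  rw [Real.norm_eq_abs, abs_mul, abs_of_pos Real.two_pi_pos]

/-- The transforms differ only by a phase that is Lipschitz in `z` with constant of order `‖w‖`; one
extra unit of weight absorbs this growth. -/
theorem seminorm_inr_rshift_sub_le (h : ℝ≥0) (f : GS E) (z z' : E) :
    gsSeminorms (Sum.inr h) (f.rshift z - f.rshift z') ≤
      2 * π * ‖z - z'‖ * gsSeminorms (Sum.inr (h + 1)) f := by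
  refine seminorm_inr_le fun w => ?_
  rw [fourier_sub_apply, fourier_rshift, fourier_rshift, ← sub_mul, norm_mul]
  have h1 : ‖(𝐞 (-⟪z, w⟫_ℝ) : ℂ) - 𝐞 (-⟪z', w⟫_ℝ)‖ ≤ 2 * π * (‖z - z'‖ * Real.exp ‖w‖) := by
    refine (norm_fourierChar_sub_le _ _).trans (mul_le_mul_of_nonneg_left ?_ (by positivity))
    rw [← abs_neg, show -(-⟪z, w⟫_ℝ - -⟪z', w⟫_ℝ) = ⟪z - z', w⟫_ℝ by
      rw [inner_sub_left]; ring]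
    refine (abs_real_inner_le_norm _ _).trans (mul_le_mul_of_nonneg_left ?_ (norm_nonneg _))
    linarith [Real.add_one_le_exp ‖w‖]
  calc _ ≤ 2 * π * (‖z - z'‖ * Real.exp ‖w‖) * ‖𝓕 (f : E → ℂ) (-w)‖ * Real.exp (h * ‖w‖) := by
        gcongr
    _ = 2 * π * ‖z - z'‖ * (‖𝓕 (f : E → ℂ) (-w)‖ * Real.exp ((h + 1 : ℝ≥0) * ‖-w‖)) := by
        rw [norm_neg]
        push_cast
        rw [add_mul, Real.exp_add, one_mul]
        ring
    _ ≤ _ := mul_le_mul_of_nonneg_left (le_seminorm_inr _ f _) (by positivity)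

theorem continuous_rshift (f : GS E) : Continuous f.rshift := by
  rw [continuous_iff_continuousAt]
  intro z₀
  have hR : ∀ h : ℝ≥0, Filter.Tendsto
      (fun z => 2 * π * ‖z - z₀‖ * gsSeminorms (Sum.inr (h + 1)) f) (nhds z₀) (nhds 0) :=
    fun h => by
      have : Continuous fun z => 2 * π * ‖z - z₀‖ * gsSeminorms (Sum.inr (h + 1)) f := by fun_prop
      simpa using this.tendsto z₀
  refine (withSeminorms.tendsto_nhds _ _).2 fun i ε hε => ?_
  rcases i with h | h
  -- In the interpolation bound the doubled-weight seminorm of the difference stays bounded near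
  -- `z₀`, while the Fourier-side factor tends to zero.
  · have hc : Continuous fun z => √((gsSeminorms (Sum.inl (2 * h)) f *
        Real.exp ((2 * h : ℝ≥0) * ‖z‖) + gsSeminorms (Sum.inl (2 * h)) f *
        Real.exp ((2 * h : ℝ≥0) * ‖z₀‖)) *
        (2 * π * ‖z - z₀‖ * gsSeminorms (Sum.inr (0 + 1 + 1)) f * expIntegral E)) := by
      fun_prop
    have ht := hc.tendsto z₀
    simp only [sub_self, norm_zero, mul_zero, zero_mul, Real.sqrt_zero] at ht
    filter_upwards [ht.eventually_lt_const hε] with z hz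
    refine ((seminorm_inl_le_sqrt h _).trans (Real.sqrt_le_sqrt ?_)).trans_lt hz
    refine mul_le_mul ?_ ?_ ?_ ?_
    · refine (map_sub_le_add _ _ _).trans (add_le_add ?_ ?_) <;>
        exact seminorm_inl_rshift_le _ f _
    · refine mul_le_mul_of_nonneg_right ?_ expIntegral_nonneg
      rw [zero_add]
      exact seminorm_inr_rshift_sub_le 1 f z z₀
    · exact mul_nonneg (apply_nonneg _ _) expIntegral_nonneg
    · exact add_nonneg (mul_nonneg (apply_nonneg _ _) (Real.exp_pos _).le)
        (mul_nonneg (apply_nonneg _ _) (Real.exp_pos _).le)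
  · filter_upwards [(hR h).eventually_lt_const hε] with z hz
    exact (seminorm_inr_rshift_sub_le h f z z₀).trans_lt hz

theorem norm_exp_mul_le {E : Type} [NormedAddCommGroup E] {k : ℝ} {c : ℂ} {x : E} {C : ℝ}
    (h : ‖c‖ * Real.exp (k * ‖x‖) ≤ C) :
    ‖(Real.exp (k * ‖x‖) : ℂ) * c‖ ≤ C := by
  rwa [norm_mul, Complex.norm_real, Real.norm_of_nonneg (Real.exp_pos _).le, mul_comm]

/-- The embedding `f ↦ (f e^{k|·|}, 𝓕 f e^{k|·|})` into a Banach space. -/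
noncomputable def embed (k : ℝ≥0) : GS E →ₗ[ℂ]
    (BoundedContinuousFunction E ℂ × BoundedContinuousFunction E ℂ) where
  toFun f :=
    (BoundedContinuousFunction.ofNormedAddCommGroup (fun x => (Real.exp (k * ‖x‖) : ℂ) * f x)
      (Continuous.mul (by fun_prop) f.continuous_coe) (wnorm k f)
      fun x => norm_exp_mul_le (norm_mul_exp_le_wnorm k f x),
    BoundedContinuousFunction.ofNormedAddCommGroup
      (fun x => (Real.exp (k * ‖x‖) : ℂ) * 𝓕 (f : E → ℂ) x)
      (Continuous.mul (by fun_prop) f.continuous_fourier) (wnorm k f)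
      fun x => norm_exp_mul_le (norm_fourier_mul_exp_le_wnorm k f x))
  map_add' f g := by
    refine Prod.ext (BoundedContinuousFunction.ext fun x => mul_add _ _ _)
      (BoundedContinuousFunction.ext fun x => ?_)
    exact (congrArg _ (congrFun (GS.fourier.map_add f g) x)).trans (mul_add _ _ _)
  map_smul' c f := by
    refine Prod.ext (BoundedContinuousFunction.ext fun x => mul_left_comm _ _ _)
      (BoundedContinuousFunction.ext fun x => ?_)
    exact (congrArg _ (congrFun (GS.fourier.map_smul c f) x)).trans (mul_left_comm _ _ _)

theorem embed_fst_apply (k : ℝ≥0) (f : GS E) (x : E) :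
    (embed k f).1 x = (Real.exp (k * ‖x‖) : ℂ) * f x := rfl

theorem embed_snd_apply (k : ℝ≥0) (f : GS E) (x : E) :
    (embed k f).2 x = (Real.exp (k * ‖x‖) : ℂ) * 𝓕 (f : E → ℂ) x := rfl

theorem norm_embed_le (k : ℝ≥0) (f : GS E) : ‖embed k f‖ ≤ wnorm k f :=
  norm_prod_le_iff.2 ⟨
    BoundedContinuousFunction.norm_ofNormedAddCommGroup_le _ (apply_nonneg _ f)
      fun x => norm_exp_mul_le (norm_mul_exp_le_wnorm k f x),
    BoundedContinuousFunction.norm_ofNormedAddCommGroup_le _ (apply_nonneg _ f)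
      fun x => norm_exp_mul_le (norm_fourier_mul_exp_le_wnorm k f x)⟩

theorem wnorm_le_norm_embed (k : ℝ≥0) (f : GS E) : wnorm k f ≤ 2 * ‖embed k f‖ := by
  refine (wnorm_le (C := ‖embed k f‖) (D := ‖embed k f‖) (fun x => ?_) (fun x => ?_)).trans_eq
    (two_mul _).symm
  · have h1 := ((embed k f).1.norm_coe_le_norm x).trans (norm_fst_le (embed k f))
    rwa [embed_fst_apply, norm_mul, Complex.norm_real, Real.norm_of_nonneg (Real.exp_pos _).le,
      mul_comm] at h1
  · have h1 := ((embed k f).2.norm_coe_le_norm x).trans (norm_snd_le (embed k f))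
    rwa [embed_snd_apply, norm_mul, Complex.norm_real, Real.norm_of_nonneg (Real.exp_pos _).le,
      mul_comm] at h1

theorem continuous_embed (k : ℝ≥0) : Continuous (embed (E := E) k) :=
  continuous_of_bound _ k 1 fun f => by simpa using norm_embed_le k f

theorem embed_injective (k : ℝ≥0) : Function.Injective (embed (E := E) k) := fun f g h => by
  ext x
  have h1 : (embed k f).1 x = (embed k g).1 x := by rw [h]
  rw [embed_fst_apply, embed_fst_apply] at h1
  exact mul_left_cancel₀ (by exact_mod_cast (Real.exp_pos _).ne') h1

/-- A continuous functional factors through a continuous functional on a Banach space. -/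
theorem exists_eq_comp_embed (a : GSDual E) : ∃ (k : ℝ≥0)
    (b : (BoundedContinuousFunction E ℂ × BoundedContinuousFunction E ℂ) →L[ℂ] ℂ),
    ∀ f, a f = b (embed k f) := by
  obtain ⟨k, C, hC⟩ := exists_bound a
  -- On the range of `embed`, `a` becomes a bounded functional because the Banach norm controls
  -- `wnorm k`; Hahn–Banach then extends it.
  let e := LinearEquiv.ofInjective (embed (E := E) k) (embed_injective k)
  let b₀ : StrongDual ℂ (LinearMap.range (embed (E := E) k)) :=
    LinearMap.mkContinuous (a.toLinearMap ∘ₗ e.symm.toLinearMap) (C * 2) fun y => by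
      obtain ⟨f, rfl⟩ := e.surjective y
      change ‖a (e.symm (e f))‖ ≤ C * 2 * ‖embed k f‖
      rw [e.symm_apply_apply, mul_assoc]
      exact (hC f).trans (mul_le_mul_of_nonneg_left (wnorm_le_norm_embed k f) C.2)
  obtain ⟨b, hb, -⟩ := exists_extension_norm_eq _ b₀
  refine ⟨k, b, fun f => ?_⟩
  have := hb (e f)
  change b (embed k f) = a (e.symm (e f)) at this
  rw [this, e.symm_apply_apply]

theorem integrable_mul_exp (H : GS E) (k : ℝ≥0) :
    Integrable fun z => ‖H z‖ * Real.exp (k * ‖z‖) := by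
  have hc := H.continuous_coe
  refine (integrable_exp_neg_norm.const_mul (wnorm (k + 1) H)).mono'
    (Continuous.aestronglyMeasurable (by fun_prop)) (Filter.Eventually.of_forall fun z => ?_)
  rw [Real.norm_of_nonneg (by positivity)]
  refine (mul_le_mul_of_nonneg_right (norm_le_wnorm (k + 1) H z) (Real.exp_pos _).le).trans_eq ?_
  rw [mul_assoc, ← Real.exp_add]
  push_cast
  ring_nf

/-- The function `w ↦ ∫ H(z) f(z - w) dz`. -/
noncomputable def corr (H f : GS E) (w : E) : ℂ := ∫ z, H z * f (z - w)

theorem continuous_corr (H f : GS E) : Continuous (corr H f) := by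
  have hH := H.continuous_coe
  have hf := f.continuous_coe
  refine continuous_of_dominated (bound := fun z => ‖H z‖ * wnorm 0 f)
    (fun w => Continuous.aestronglyMeasurable (by fun_prop))
    (fun w => Filter.Eventually.of_forall fun z => ?_) (H.integrable.norm.mul_const _)
    (Filter.Eventually.of_forall fun z => by fun_prop)
  rw [norm_mul]
  refine mul_le_mul_of_nonneg_left ?_ (norm_nonneg _)
  simpa using norm_mul_exp_le_wnorm 0 f (z - w)

theorem expDecay_corr (H f : GS E) : ExpDecay (corr H f) := fun h hh => by
  lift h to ℝ≥0 using hh.le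
  refine ⟨∫ z, ‖H z‖ * Real.exp (h * ‖z‖) * wnorm h f, fun w => ?_⟩
  rw [corr, ← Real.norm_of_nonneg (Real.exp_pos (h * ‖w‖)).le, ← Complex.norm_real, ← norm_mul,
    ← integral_mul_const]
  refine norm_integral_le_of_norm_le ((H.integrable_mul_exp h).mul_const _)
    (Filter.Eventually.of_forall fun z => ?_)
  rw [norm_mul, norm_mul, Complex.norm_real, Real.norm_of_nonneg (Real.exp_pos _).le,
    mul_assoc, mul_assoc]
  refine mul_le_mul_of_nonneg_left ?_ (norm_nonneg _)
  have h1 : ‖w‖ ≤ ‖z‖ + ‖z - w‖ := by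
    simpa using norm_sub_le z (z - w)
  calc ‖f (z - w)‖ * Real.exp (h * ‖w‖)
      ≤ ‖f (z - w)‖ * Real.exp (h * ‖z‖ + h * ‖z - w‖) := by
        rw [← mul_add]; gcongr
    _ = Real.exp (h * ‖z‖) * (‖f (z - w)‖ * Real.exp (h * ‖z - w‖)) := by
        rw [Real.exp_add]; ring
    _ ≤ _ := mul_le_mul_of_nonneg_left (norm_mul_exp_le_wnorm h f _) (Real.exp_pos _).le

/-- The correlation is the convolution of `H` with the reflection of `f`, so its transform is a
product. -/
theorem fourier_corr (H f : GS E) (w : E) :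
    𝓕 (corr H f) w = 𝓕 (H : E → ℂ) w * 𝓕 (f : E → ℂ) (-w) := by
  have h1 : corr H f = convolution H f.refl (ContinuousLinearMap.mul ℂ ℂ) volume := by
    funext w
    simp [corr, convolution]
  have h2 : 𝓕 (f.refl : E → ℂ) w = 𝓕 (f : E → ℂ) (-w) := by
    have := fourier_rshift f 0 w
    rwa [inner_zero_left, neg_zero, AddChar.map_zero_eq_one, Circle.coe_one, one_mul] at this
  rw [h1, Real.fourier_mul_convolution_eq H.integrable f.refl.integrable, h2]

/-- The function `w ↦ ∫ H(z) f(z - w) dz` as an element of the Gelfand–Shilov space. -/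
noncomputable def corrGS (H f : GS E) : GS E :=
  ⟨corr H f, continuous_corr H f, expDecay_corr H f, fun h hh => by
    obtain ⟨C, hC⟩ := H.expDecay_fourier h hh
    refine ⟨C * wnorm 0 f, fun w => ?_⟩
    rw [fourier_corr, norm_mul, mul_right_comm]
    refine mul_le_mul (hC w) ?_ (norm_nonneg _) ((by positivity : (0 : ℝ) ≤ _).trans (hC w))
    simpa using norm_fourier_mul_exp_le_wnorm 0 f (-w)⟩

@[simp] theorem corrGS_apply (H f : GS E) (w : E) : corrGS H f w = ∫ z, H z * f (z - w) := rfl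

theorem integrable_smul_embed_rshift (H f : GS E) (k : ℝ≥0) :
    Integrable fun z => H z • embed k (f.rshift z) := by
  -- The target need not be separable; strong measurability of the continuous integrand comes from
  -- second countability of `E`.
  have : SecondCountableTopologyEither E
    (BoundedContinuousFunction E ℂ × BoundedContinuousFunction E ℂ) := ⟨Or.inl inferInstance⟩
  refine ((H.integrable_mul_exp k).mul_const (wnorm k f)).mono'
    (Continuous.aestronglyMeasurable ?_) (Filter.Eventually.of_forall fun z => ?_)
  · exact H.continuous_coe.smul ((continuous_embed k).comp f.continuous_rshift)
  · rw [norm_smul, mul_assoc, mul_comm (Real.exp _)]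
    exact mul_le_mul_of_nonneg_left
      ((norm_embed_le k _).trans (wnorm_rshift_le k f z)) (norm_nonneg _)

/-- Point evaluations are continuous and commute with the Bochner integral, so each component is
checked pointwise. On the Fourier side the phases of the translates integrate against `H` to `𝓕 H`.
-/
theorem embed_corrGS (H f : GS E) (k : ℝ≥0) :
    embed k (corrGS H f) = ∫ z, H z • embed k (f.rshift z) := by
  have hI := integrable_smul_embed_rshift H f k
  have hfst (x : E) := ((BoundedContinuousFunction.evalCLM ℂ x).comp
    (ContinuousLinearMap.fst ℂ _ _)).integral_comp_comm hI
  have hsnd (x : E) := ((BoundedContinuousFunction.evalCLM ℂ x).comp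
    (ContinuousLinearMap.snd ℂ _ _)).integral_comp_comm hI
  refine Prod.ext (BoundedContinuousFunction.ext fun x => ?_)
    (BoundedContinuousFunction.ext fun x => ?_)
  · refine Eq.trans ?_ (hfst x)
    rw [embed_fst_apply, corrGS_apply, ← integral_const_mul]
    refine integral_congr_ae (Filter.Eventually.of_forall fun z => ?_)
    exact mul_left_comm _ _ _
  · refine Eq.trans ?_ (hsnd x)
    rw [embed_snd_apply]
    change _ * 𝓕 (corr H f) x = _
    rw [fourier_corr, fourier_eq_mul (H : E → ℂ), ← integral_mul_const, ← integral_const_mul]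
    refine integral_congr_ae (Filter.Eventually.of_forall fun z => ?_)
    change _ = H z * ((Real.exp (k * ‖x‖) : ℂ) * 𝓕 (f.rshift z : E → ℂ) x)
    rw [fourier_rshift]
    ring

theorem integrable_apply_rshift_mul (a : GSDual E) (H f : GS E) :
    Integrable fun z => a (f.rshift z) * H z := by
  obtain ⟨k, b, hb⟩ := exists_eq_comp_embed a
  have := b.integrable_comp (integrable_smul_embed_rshift H f k)
  simpa only [map_smul, ← hb, smul_eq_mul, mul_comm] using this

/-- A continuous functional may be interchanged with the integral. -/
theorem apply_corrGS (a : GSDual E) (H f : GS E) :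
    a (corrGS H f) = ∫ z, a (f.rshift z) * H z := by
  obtain ⟨k, b, hb⟩ := exists_eq_comp_embed a
  rw [hb, embed_corrGS, ← b.integral_comp_comm (integrable_smul_embed_rshift H f k)]
  simp only [map_smul, ← hb, smul_eq_mul, mul_comm]

/-- The functional `H ↦ ∫ a(f(z - ·)) H(z) dz`. -/
noncomputable def convLinear (a : GSDual E) (f : GS E) : GS E →ₗ[ℂ] ℂ where
  toFun H := ∫ z, a (f.rshift z) * H z
  map_add' H H' := by
    simp only [add_apply, mul_add]
    exact integral_add (integrable_apply_rshift_mul a H f) (integrable_apply_rshift_mul a H' f)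
  map_smul' c H := by
    simp only [smul_apply, mul_left_comm _ c, RingHom.id_apply, smul_eq_mul]
    exact integral_const_mul _ _

/-- The convolution of a continuous functional with a Gelfand–Shilov function. -/
noncomputable def convDual (a : GSDual E) (f : GS E) : GSDual E where
  toLinearMap := convLinear a f
  cont := by
    obtain ⟨k, C, hC⟩ := exists_bound a
    refine continuous_of_bound (convLinear a f) (k + 1)
      (C * wnorm k f * expIntegral E) fun H => ?_
    refine (norm_integral_le_of_norm_le (integrable_exp_neg_norm.const_mul
      (C * wnorm k f * wnorm (k + 1) H)) (Filter.Eventually.of_forall fun z => ?_)).trans_eq ?_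
    · rw [norm_mul]
      calc ‖a (f.rshift z)‖ * ‖H z‖
          ≤ (C * (wnorm k f * Real.exp (k * ‖z‖))) *
            (wnorm (k + 1) H * Real.exp (-((k + 1 : ℝ≥0) * ‖z‖))) := by
            refine mul_le_mul ((hC _).trans (mul_le_mul_of_nonneg_left (wnorm_rshift_le k f z) C.2))
              (norm_le_wnorm _ H z) (norm_nonneg _) ?_
            exact mul_nonneg C.2 (mul_nonneg (apply_nonneg _ _) (Real.exp_pos _).le)
        _ = C * wnorm k f * wnorm (k + 1) H *
            (Real.exp (k * ‖z‖) * Real.exp (-((k + 1 : ℝ≥0) * ‖z‖))) := by ring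
        _ = _ := by
            rw [← Real.exp_add]
            push_cast
            ring_nf
    · rw [integral_const_mul, ← expIntegral]
      ring

theorem convDual_apply (a : GSDual E) (f H : GS E) :
    convDual a f H = ∫ z, a (f.rshift z) * H z := rfl

theorem isConvolution_convDual (a : GSDual E) (f : GS E) :
    IsConvolution a f (convDual a f) :=
  ⟨fun z => a (f.rshift z), fun z => ⟨f.rshift z, fun _ => rfl, rfl⟩,
    fun H => ⟨integrable_apply_rshift_mul a H f, rfl⟩⟩

theorem _root_.IsConvolution.eq_convDual {a : GSDual E} {f : GS E} {σ : GSDual E}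
    (h : IsConvolution a f σ) : σ = convDual a f := by
  obtain ⟨s, hs, hσ⟩ := h
  refine ContinuousLinearMap.ext fun H => ?_
  rw [(hσ H).2, convDual_apply]
  refine integral_congr_ae (Filter.Eventually.of_forall fun z => ?_)
  obtain ⟨R, hR, hsz⟩ := hs z
  have : R = f.rshift z := GS.ext hR
  simp only [hsz, this]

end GS

end Convolution

/-! ### Weyl operators and localization operators. -/

section Operators

variable {E : Type} [NormedAddCommGroup E] [InnerProductSpace ℝ E] [FiniteDimensional ℝ E]
  [MeasurableSpace E] [BorelSpace E]

namespace GS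

theorem norm_apply_wig_le (σ : GSDual (Phase E)) :
    ∃ (k : ℝ≥0) (C : ℝ), 0 ≤ C ∧ ∀ F g : GS E, ‖σ (wig F g.conj)‖ ≤ C * wnorm k F * wnorm k g := by
  obtain ⟨k, C, hC⟩ := exists_bound σ
  refine ⟨2 * k + 1, C * (2 * expIntegral E),
    mul_nonneg C.2 (mul_nonneg zero_le_two expIntegral_nonneg), fun F g => ?_⟩
  refine (hC _).trans ((mul_le_mul_of_nonneg_left (wnorm_wig_le k F g.conj)
    (NNReal.coe_nonneg C)).trans_eq ?_)
  rw [wnorm_conj]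
  ring

/-- The functional `g ↦ σ (W(F, conj g))`. -/
noncomputable def weylFunctional (σ : GSDual (Phase E)) (F : GS E) : GSDual E :=
  let L : GS E →ₗ[ℂ] ℂ :=
    { toFun := fun g => σ (wig F g.conj)
      map_add' := fun g g' => by rw [conj_add, wig_add_right, map_add]
      map_smul' := fun c g => by
        rw [conj_smul, wig_smul_right, map_smul, Complex.conj_conj, RingHom.id_apply] }
  ⟨L, by
    obtain ⟨k, C, -, hC⟩ := norm_apply_wig_le σ
    exact continuous_of_bound L k (C * wnorm k F) (hC F)⟩

/-- The Weyl operator with symbol `σ`, as a linear map. -/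
noncomputable def weylLinear (σ : GSDual (Phase E)) : GS E →ₗ[ℂ] GSDual E where
  toFun := weylFunctional σ
  map_add' F F' := ContinuousLinearMap.ext fun g =>
    (congrArg σ (wig_add_left F F' g.conj)).trans (map_add σ _ _)
  map_smul' c F := ContinuousLinearMap.ext fun g =>
    (congrArg σ (wig_smul_left c F g.conj)).trans (map_smul σ _ _)

/-- The Weyl operator with symbol `σ`. -/
noncomputable def weyl (σ : GSDual (Phase E)) : GS E →L[ℂ] GSDual E where
  toLinearMap := weylLinear σ
  cont := by
    change Continuous (weylLinear σ)
    refine continuous_of_continuousAt_zero (weylLinear σ) ?_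
    rw [ContinuousAt, map_zero]
    -- Neighbourhoods of zero in the strong dual ask for smallness uniformly on a bounded set `S`.
    -- Boundedness of `S` bounds both halves of `wnorm k` by `r` and `r'`, and the bilinear estimate
    -- does the rest.
    refine (ContinuousLinearMap.hasBasis_nhds_zero_of_basis
      Metric.nhds_basis_ball).tendsto_right_iff.2 ?_
    rintro ⟨S, ε⟩ ⟨hS, hε⟩
    obtain ⟨k, C, hC0, hC⟩ := norm_apply_wig_le σ
    obtain ⟨r, hr, hrS⟩ := withSeminorms.isVonNBounded_iff_seminorm_bounded.1 hS (Sum.inl k)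
    obtain ⟨r', hr', hrS'⟩ := withSeminorms.isVonNBounded_iff_seminorm_bounded.1 hS (Sum.inr k)
    have ht : Filter.Tendsto (fun F : GS E => C * wnorm k F * (r + r')) (nhds 0) (nhds 0) := by
      have hc := continuous_wnorm (E := E) k
      have : Continuous fun F : GS E => C * wnorm k F * (r + r') := by fun_prop
      simpa using this.tendsto 0
    filter_upwards [ht.eventually_lt_const hε] with F hF g hg
    rw [mem_ball_zero_iff]
    refine ((hC F g).trans (mul_le_mul_of_nonneg_left ?_
      (mul_nonneg hC0 (apply_nonneg _ _)))).trans_lt hF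
    exact add_le_add (hrS g hg).le (hrS' g hg).le

theorem bracket_weyl (σ : GSDual (Phase E)) (F G : GS E) :
    bracket (weyl σ F) G = σ (wig F G) := by
  change σ (wig F G.conj.conj) = _
  rw [conj_conj]

theorem ext_bracket {A L : GS E →L[ℂ] GSDual E}
    (h : ∀ F G, bracket (A F) G = bracket (L F) G) : A = L := by
  refine ContinuousLinearMap.ext fun F => ContinuousLinearMap.ext fun g => ?_
  have := h F g.conj
  rwa [bracket, bracket, conj_conj] at this

theorem wigner_eq_weyl_integral (F G : E → ℂ) (z : Phase E) :
    wigner F G z = ∫ t, F (z.fst - (2⁻¹ : ℝ) • t) * conj (G (z.fst + (2⁻¹ : ℝ) • t)) *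
      Complex.exp (2 * π * Complex.I * (⟪t, z.snd⟫_ℝ : ℝ)) := by
  rw [wigner, ← integral_neg_eq_self]
  refine integral_congr_ae (Filter.Eventually.of_forall fun t => ?_)
  simp only [smul_neg, sub_neg_eq_add, ← sub_eq_add_neg, inner_neg_right, real_inner_comm t]
  push_cast
  simp only [mul_neg, neg_neg]

theorem isWeylOperator_weyl (σ : GSDual (Phase E)) : IsWeylOperator σ (weyl σ) := fun F G =>
  ⟨wig F G, fun z => wigner_eq_weyl_integral F G z, bracket_weyl σ F G⟩

theorem _root_.IsWeylOperator.eq_weyl {σ : GSDual (Phase E)} {L : GS E →L[ℂ] GSDual E}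
    (h : IsWeylOperator σ L) : L = weyl σ := by
  refine ext_bracket fun F G => ?_
  obtain ⟨H, hH, hL⟩ := h F G
  have : H = wig F G := GS.ext fun z => (hH z).trans (wigner_eq_weyl_integral F G z).symm
  rw [hL, bracket_weyl, this]

/-- The heart of the theorem: `apply_corrGS` moves `a` outside the convolution pairing, and Moyal's
identity recognizes the resulting test function. -/
theorem isLocalizationOperator_weyl (a : GSDual (Phase E)) (φ ψ : GS E) :
    IsLocalizationOperator a φ ψ (weyl (convDual a (wig ψ φ))) := fun F G => by
  -- The correlation equals `V_φ F · conj (V_ψ G)`; the witness is its conjugate because `bracket`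
  -- conjugates its second argument.
  refine ⟨(corrGS (wig F G) (wig ψ φ)).conj, fun z => ?_, ?_⟩
  · rw [conj_apply, corrGS_apply]
    simp only [wig_apply]
    rw [integral_wigner_mul_wigner_sub, map_mul, Complex.conj_conj]
  · rw [bracket_weyl, bracket, conj_conj, apply_corrGS, convDual_apply]

theorem _root_.IsLocalizationOperator.unique {a : GSDual (Phase E)} {φ ψ : GS E}
    {A B : GS E →L[ℂ] GSDual E} (hA : IsLocalizationOperator a φ ψ A)
    (hB : IsLocalizationOperator a φ ψ B) : A = B := by
  refine ext_bracket fun F G => ?_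
  obtain ⟨H, hH, h1⟩ := hA F G
  obtain ⟨H', hH', h2⟩ := hB F G
  have : H = H' := GS.ext fun z => (hH z).trans (hH' z).symm
  rw [h1, h2, this]

end GS

end Operators

/-! ### Tensor products and the conclusion. -/

/-- The inner product is a sum over blocks, so the phase, like the windows, factors into functions
of single blocks; the integral of such a product is the product of the integrals. -/
theorem wigner_tensor {n d : ℕ} (ϕ φ : Fin n → GS (Eucl d)) :
    wigner (GS.tensor ϕ) (GS.tensor φ) =
      fun z => ∏ j, wigner (ϕ j) (φ j) (phaseBlock j z) := by
  funext z
  simp only [wigner]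
  rw [← integral_prod_block]
  refine integral_congr_ae (Filter.Eventually.of_forall fun t => ?_)
  simp only [Finset.prod_mul_distrib, ← Complex.exp_sum]
  rw [inner_eq_sum_block, ← map_prod]
  congr 2
  push_cast
  rw [Finset.mul_sum, Finset.sum_neg_distrib]
  rfl

theorem mainTheorem2 (n d : ℕ) (a : GSDual (Phase (MEucl n d))) (φ ϕ : Fin n → GS (Eucl d)) :
    -- the localization operator, the symbol and the Weyl operators are well defined
    (∃! A : GS (MEucl n d) →L[ℂ] GSDual (MEucl n d),
      IsLocalizationOperator a (GS.tensor φ) (GS.tensor ϕ) A) ∧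
    (∃! σ : GSDual (Phase (MEucl n d)),
      IsConvolution a (wigner (GS.tensor ϕ) (GS.tensor φ)) σ) ∧
    (∀ σ : GSDual (Phase (MEucl n d)), ∃! L : GS (MEucl n d) →L[ℂ] GSDual (MEucl n d),
      IsWeylOperator σ L) ∧
    -- the multilinear Wigner transform of the windows is a product
    (wigner (GS.tensor ϕ) (GS.tensor φ) =
      fun z => ∏ j, wigner (ϕ j) (φ j) (phaseBlock j z)) ∧
    -- the localization operator is the Weyl operator with symbol `σ = a ∗ W(ϕ, φ)`
    (∀ (A L : GS (MEucl n d) →L[ℂ] GSDual (MEucl n d)) (σ : GSDual (Phase (MEucl n d))),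
      IsLocalizationOperator a (GS.tensor φ) (GS.tensor ϕ) A →
      IsConvolution a (wigner (GS.tensor ϕ) (GS.tensor φ)) σ →
      IsWeylOperator σ L →
      A = L ∧
        ∀ f g : Fin n → GS (Eucl d),
          bracket (A (GS.tensor f)) (GS.tensor g) = bracket (L (GS.tensor f)) (GS.tensor g)) := by
  have hloc := GS.isLocalizationOperator_weyl a (GS.tensor φ) (GS.tensor ϕ)
  refine ⟨⟨_, hloc, fun B hB => hB.unique hloc⟩,
    ⟨_, GS.isConvolution_convDual a (GS.wig (GS.tensor ϕ) (GS.tensor φ)),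
      fun σ hσ => IsConvolution.eq_convDual (f := GS.wig (GS.tensor ϕ) (GS.tensor φ)) hσ⟩,
    fun σ => ⟨_, GS.isWeylOperator_weyl σ, fun L hL => hL.eq_weyl⟩, wigner_tensor ϕ φ,
    fun A L σ hA hσ hL => ?_⟩
  have hAL : A = L := by
    rw [hL.eq_weyl, IsConvolution.eq_convDual (f := GS.wig (GS.tensor ϕ) (GS.tensor φ)) hσ]
    exact hA.unique hloc
  exact ⟨hAL, fun f g => by rw [hAL]⟩
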